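/- Let $\Lambda=\mathbb{Z}[h_1,h_2,\dots]$ be the ring of symmetric functions, with complete symmetric functions $h_n$ and power sums $p_n$. A pre-$\lambda$-ring is a commutative ring $R$ with operations $\sigma_n:R\to R$, $n\ge0$, such that $\sigma_0(a)=1$, $\sigma_1(a)=a$ and $\sigma_n(a+b)=\sum_{i+j=n}\sigma_i(a)\sigma_j(b)$; for $f\in\Lambda$ the operation $a\mapsto f\circ a$ is defined by $(h_{n_1}\cdots h_{n_k})\circ a=\sigma_{n_1}(a)\cdots\sigma_{n_k}(a)$ and linearity in $f$, and $\psi_n(a)=p_n\circ a$. It is a $\lambda$-ring if $f\circ(g\circ x)=(f\circ g)\circ x$ for all $f,g\in\Lambda$, $x\in R$, where $f\circ g$ is plethysm in $\Lambda$ (computed in $\mathbb{Z}[x_1,\dots,x_N]$ for all $N$, with the pre-$\lambda$-structure in which $\sigma_n(x^m)=x^{nm}$ for every monomial $x^m$). A complete filtered $\lambda$-ring is a $\lambda$-ring with a decreasing filtration $R=F_0R\supset F_1R\supset\cdots$ by additive subgroups such that $\bigcap_kF_kR=0$, $F_mR\cdot F_nR\subset F_{m+n}R$, $\sigma_m(F_nR)\subset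 F_{mn}R$, and $R\to\varprojlim R/F_kR$ is an isomorphism. **Proposition.** (1) For every $n\ge1$ the degree $n$ part (with $p_k$ of degree $k$) $$\mathrm{Log}_n=\sum_{dm=n}\frac{\mu(d)}{d}\,\frac{(-1)^{m-1}}{m}\,p_d^{\,m}\in\Lambda\otimes\mathbb{Q}$$ of the formal series $\sum_{d\ge1}\frac{\mu(d)}{d}\log(1+p_d)$ lies in $\Lambda$, and $(-1)^{n-1}\mathrm{Log}_n$ is the Frobenius characteristic of the complex $S_n$-module $\mathrm{Ind}_{C_n}^{S_n}\chi_n\otimes\varepsilon_n$, where $C_n\subset S_n$ is generated by an $n$-cycle, $\chi_n$ is the character of $C_n$ equal to $e^{2\pi i/n}$ on this generator, and $\varepsilon_n$ is the sign representation of $S_n$. (So $(-1)^{n-1}\mathrm{Log}_n$ is the operation on $\lambda$-rings attached to this module.) (2) Let $R$ be a complete filtered $\lambda$-ring. Then $a\mapsto\mathrm{Log}_n(a):=\mathrm{Log}_n\circ a$ maps $F_1R$ to $F_nR$ for every $n\ge1$. For every $a\in F_1R$ the series $$\mathrm{Exp}(a)=\sum_{n\ge0}\sigma_n(a)$$ converges,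 and $\mathrm{Exp}$ is a bijection from $F_1R$ onto $1+F_1R$. Its inverse is $$\mathrm{Log}(1+a)=\sum_{n\ge1}\frac{\mu(n)}{n}\log(1+\psi_n(a)),\qquad a\in F_1R,$$ understood as the convergent series $\sum_{n\ge1}\mathrm{Log}_n(a)$, which needs no division by integers in $R$. If $R$ is a $\mathbb{Q}$-algebra, the displayed formula also holds literally, as a convergent series of convergent logarithm series $\log(1+\psi_n(a))=\sum_{m\ge1}\frac{(-1)^{m-1}}{m}\psi_n(a)^m$. -/

import Mathlib

noncomputable section

namespace CompleteLambda

open MvPolynomial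

/-- A pre-`λ`-ring: a commutative ring `R` with operations `σ n : R → R` whose generating function
`σ_t(a) = ∑ n, σ n a * t ^ n` satisfies `σ_t(a) = 1 + t a + O(t²)` and
`σ_t(a + b) = σ_t(a) σ_t(b)`. -/
structure PreLambdaRing (R : Type*) [CommRing R] where
  σ : ℕ → R → R
  σ_zero : ∀ a, σ 0 a = 1
  σ_one : ∀ a, σ 1 a = a
  σ_add : ∀ n a b,
    σ n (a + b) = ∑ ij ∈ Finset.HasAntidiagonal.antidiagonal n, σ ij.1 a * σ ij.2 b

/-- The ring of symmetric functions `Λ = ℤ[h₁, h₂, …]`, the polynomial ring on the complete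
symmetric functions; the variable `X n` is `h_{n+1}`. See `toVars` for the realization by
symmetric polynomials. -/
abbrev SymFun : Type := MvPolynomial ℕ ℤ

/-- The complete symmetric function `h_n`, with `h_0 = 1`. -/
def hSym : ℕ → SymFun
  | 0 => 1
  | n + 1 => X n

/-- The power sum `p_n` (`n ≥ 1`), through Newton's formula
`n h_n = p_n + h_1 p_{n-1} + ⋯ + h_{n-1} p_1`. (The value at `0` is a dummy.) -/
def pSym : ℕ → SymFun
  | 0 => 0
  | n + 1 => ((n + 1 : ℕ) : SymFun) * hSym (n + 1) - ∑ r : Fin n, hSym (n - r) * pSym (r + 1)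
termination_by n => n
decreasing_by have := r.2; omega

/-- The realization of `Λ` in `k` variables: the ring homomorphism `Λ → ℤ[x_1, …, x_k]` sending
`h_n` to the complete homogeneous symmetric polynomial of degree `n`. These maps, for all `k`,
identify `Λ` with the (graded) inverse limit of the rings `ℤ[x_1, …, x_k]^{S_k}`. -/
def toVars (k : ℕ) : SymFun →ₐ[ℤ] MvPolynomial (Fin k) ℤ :=
  aeval fun n => hsymm (Fin k) ℤ (n + 1)

section Operations

variable {R : Type*} [CommRing R] (S : PreLambdaRing R)

/-- The operation `f ∘ a` of `f ∈ Λ` on an element `a` of a pre-`λ`-ring: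
`(h_{n₁} ⋯ h_{n_k}) ∘ a = σ_{n₁}(a) ⋯ σ_{n_k}(a)`, extended linearly in `f`. -/
def PreLambdaRing.act (f : SymFun) (a : R) : R :=
  aeval (fun n => S.σ (n + 1) a) f

/-- The Adams operation `ψ_n`, the operation of the power sum `p_n`. -/
def PreLambdaRing.ψ (n : ℕ) (a : R) : R :=
  S.act (pSym n) a

end Operations

section Polynomials

variable {ι : Type*}

/-- For a monomial `x^m`, the invertible power series `(1 - t x^m)⁻¹ = ∑ n, t^n x^{n m}`. -/
def geomUnit (m : ι →₀ ℕ) : (PowerSeries (MvPolynomial ι ℤ))ˣ where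
  val := PowerSeries.mk fun n => monomial (n • m) 1
  inv := 1 - PowerSeries.C (monomial m 1) * PowerSeries.X
  val_inv := by
    ext1 n
    rw [mul_sub, mul_one, map_sub, ← mul_assoc]
    cases n with
    | zero => simp
    | succ n =>
      rw [PowerSeries.coeff_succ_mul_X, PowerSeries.coeff_mul_C]
      simp [PowerSeries.coeff_one, monomial_mul, succ_nsmul]
  inv_val := by
    ext1 n
    rw [mul_comm, mul_sub, mul_one, map_sub, ← mul_assoc]
    cases n with
    | zero => simp
    | succ n =>
      rw [PowerSeries.coeff_succ_mul_X, PowerSeries.coeff_mul_C]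
      simp [PowerSeries.coeff_one, monomial_mul, succ_nsmul]

/-- `σ_t(∑ c_m x^m) = ∏ (1 - t x^m)^{-c_m}` on a polynomial ring over `ℤ`. -/
def sigmaT (f : MvPolynomial ι ℤ) : (PowerSeries (MvPolynomial ι ℤ))ˣ :=
  ∏ m ∈ f.support, geomUnit m ^ (coeff m f)

lemma sigmaT_add (f g : MvPolynomial ι ℤ) : sigmaT (f + g) = sigmaT f * sigmaT g := by
  classical
  have key : ∀ (q : MvPolynomial ι ℤ) (s : Finset (ι →₀ ℕ)), q.support ⊆ s →
      sigmaT q = ∏ m ∈ s, geomUnit m ^ (coeff m q) := by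
    intro q s hs
    refine Finset.prod_subset hs fun m _ hm => ?_
    rw [notMem_support_iff.mp hm, zpow_zero]
  rw [key (f + g) (f.support ∪ g.support) support_add,
    key f (f.support ∪ g.support) Finset.subset_union_left,
    key g (f.support ∪ g.support) Finset.subset_union_right, ← Finset.prod_mul_distrib]
  exact Finset.prod_congr rfl fun m _ => by rw [coeff_add, zpow_add]

/-- Power series of the form `1 + t a + O(t²)`. -/
def StartsWith {A : Type*} [CommRing A] (u : (PowerSeries A)ˣ) (a : A) : Prop :=
  PowerSeries.coeff 0 (u : PowerSeries A) = 1 ∧ PowerSeries.coeff 1 (u : PowerSeries A) = a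

lemma units_coeff_one_mul {A : Type*} [CommRing A] (u v : (PowerSeries A)ˣ) :
    PowerSeries.coeff 1 ((u * v : (PowerSeries A)ˣ) : PowerSeries A) =
      PowerSeries.coeff 0 (u : PowerSeries A) * PowerSeries.coeff 1 (v : PowerSeries A) +
      PowerSeries.coeff 1 (u : PowerSeries A) * PowerSeries.coeff 0 (v : PowerSeries A) := by
  have e : Finset.HasAntidiagonal.antidiagonal 1 = {((0 : ℕ), (1 : ℕ)), (1, 0)} := rfl
  rw [Units.val_mul, PowerSeries.coeff_mul, e, Finset.sum_pair (by simp)]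

lemma StartsWith.mul {A : Type*} [CommRing A] {u v : (PowerSeries A)ˣ} {a b : A}
    (hu : StartsWith u a) (hv : StartsWith v b) : StartsWith (u * v) (a + b) := by
  obtain ⟨h0, h1⟩ := hu
  obtain ⟨k0, k1⟩ := hv
  constructor
  · rw [Units.val_mul, PowerSeries.coeff_mul, Finset.Nat.antidiagonal_zero, Finset.sum_singleton,
      h0, k0, one_mul]
  · rw [units_coeff_one_mul, h0, h1, k0, k1]
    ring

lemma StartsWith.one {A : Type*} [CommRing A] : StartsWith (1 : (PowerSeries A)ˣ) 0 := by
  simp [StartsWith, PowerSeries.coeff_one]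

lemma StartsWith.inv {A : Type*} [CommRing A] {u : (PowerSeries A)ˣ} {a : A}
    (hu : StartsWith u a) : StartsWith u⁻¹ (-a) := by
  have h0 : PowerSeries.coeff 0 ((u * u⁻¹ : (PowerSeries A)ˣ) : PowerSeries A) = 1 := by simp
  have h1 : PowerSeries.coeff 1 ((u * u⁻¹ : (PowerSeries A)ˣ) : PowerSeries A) = 0 := by
    simp [PowerSeries.coeff_one]
  obtain ⟨k0, k1⟩ := hu
  rw [Units.val_mul, PowerSeries.coeff_mul, Finset.Nat.antidiagonal_zero, Finset.sum_singleton, k0,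
    one_mul] at h0
  rw [units_coeff_one_mul, k0, k1, h0] at h1
  refine ⟨h0, ?_⟩
  linear_combination h1

lemma StartsWith.zpow {A : Type*} [CommRing A] {u : (PowerSeries A)ˣ} {a : A}
    (hu : StartsWith u a) (z : ℤ) : StartsWith (u ^ z) (z • a) := by
  have hn : ∀ n : ℕ, StartsWith (u ^ n) (n • a) := by
    intro n
    induction n with
    | zero => simpa using StartsWith.one
    | succ n ih => simpa only [pow_succ, succ_nsmul] using ih.mul hu
  cases z with
  | ofNat n => simpa using hn n
  | negSucc n => simpa only [zpow_negSucc, negSucc_zsmul] using (hn (n + 1)).inv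

lemma sigmaT_startsWith (f : MvPolynomial ι ℤ) : StartsWith (sigmaT f) f := by
  have key : ∀ s : Finset (ι →₀ ℕ), StartsWith (∏ m ∈ s, geomUnit m ^ (coeff m f))
      (∑ m ∈ s, monomial m (coeff m f)) := by
    classical
    intro s
    induction s using Finset.induction_on with
    | empty => simpa using StartsWith.one
    | insert m s hm ih =>
      rw [Finset.prod_insert hm, Finset.sum_insert hm]
      refine StartsWith.mul ?_ ih
      have : StartsWith (geomUnit m) (monomial m (1 : ℤ)) := by
        constructor <;> simp [geomUnit]
      simpa [smul_monomial] using this.zpow (coeff m f)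
  have := key f.support
  rwa [support_sum_monomial_coeff] at this

/-- The pre-`λ`-ring structure on a polynomial ring over `ℤ`, characterized by
`σ_n(x^m) = x^{n m}` for every monomial `x^m`. -/
def polyPreLambda (ι : Type*) : PreLambdaRing (MvPolynomial ι ℤ) where
  σ n f := PowerSeries.coeff n (sigmaT f : PowerSeries (MvPolynomial ι ℤ))
  σ_zero f := (sigmaT_startsWith f).1
  σ_one f := (sigmaT_startsWith f).2
  σ_add n f g := by rw [sigmaT_add, Units.val_mul, PowerSeries.coeff_mul]

end Polynomials

/-- `k = f ∘ g` in `Λ` (plethysm). The pre-`λ`-ring structure of `Λ` is the one for which the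
realizations `Λ → ℤ[x_1, …, x_N]` are morphisms of pre-`λ`-rings, so `k` is the element of `Λ`
realized, in each number `N` of variables, by the operation of `f` on the realization of `g`.
Such `k` exists, as the operations on `ℤ[x_1, …, x_N]` preserve symmetric polynomials, are
compatible with setting variables to `0`, and do not raise degrees beyond a bound depending on
`f` and `g` only; and it is unique, as the realizations are jointly injective. -/
def IsPlethysm (f g k : SymFun) : Prop :=
  ∀ N : ℕ, toVars N k = (polyPreLambda (Fin N)).act f (toVars N g)

/-- A `λ`-ring: a pre-`λ`-ring in which `f ∘ (g ∘ x) = (f ∘ g) ∘ x` for `f, g ∈ Λ`, `x ∈ R`. -/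
structure LambdaRing (R : Type*) [CommRing R] extends PreLambdaRing R where
  act_act : ∀ (f g k : SymFun), IsPlethysm f g k →
    ∀ x : R, toPreLambdaRing.act f (toPreLambdaRing.act g x) = toPreLambdaRing.act k x

/-- A filtered `λ`-ring: a `λ`-ring with a decreasing filtration `R = F 0 ⊇ F 1 ⊇ ⋯` by additive
subgroups, separated and compatible with products and with the `σ`-operations. -/
structure FilteredLambdaRing (R : Type*) [CommRing R] extends LambdaRing R where
  F : ℕ → AddSubgroup R
  F_zero : F 0 = ⊤
  F_antitone : Antitone F
  F_iInf : ⨅ k, F k = ⊥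
  F_mul : ∀ m n a b, a ∈ F m → b ∈ F n → a * b ∈ F (m + n)
  F_sigma : ∀ m n a, a ∈ F n → σ m a ∈ F (m * n)

section Filtered

variable {R : Type*} [CommRing R] (S : FilteredLambdaRing R)

/-- `R` equals its completion: the (injective) map `R → lim R / F k` is surjective, i.e. every
compatible sequence of residue classes comes from an element of `R`. -/
def FilteredLambdaRing.IsComplete : Prop :=
  ∀ u : ℕ → R, (∀ k, u (k + 1) - u k ∈ S.F k) → ∃ s, ∀ k, s - u k ∈ S.F k

/-- The series `∑ n ≥ 0, u n` converges to `s` for the filtration. (As the filtration is separated,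
`s` is unique.) -/
def FilteredLambdaRing.HasSeriesSum (u : ℕ → R) (s : R) : Prop :=
  ∀ k, ∃ N, ∀ n ≥ N, (∑ i ∈ Finset.range n, u i) - s ∈ S.F k

end Filtered

/-- The part of degree `N` (where `p_n` has degree `n`) of the formal series
`∑ n ≥ 1, (μ(n) / n) log(1 + p_n) = ∑ n, m ≥ 1, (μ(n) / n) ((-1)^(m-1) / m) p_n^m`
with coefficients in `Λ ⊗ ℚ`. -/
def logPart (N : ℕ) : MvPolynomial ℕ ℚ :=
  ∑ nm ∈ N.divisorsAntidiagonal,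
    C ((ArithmeticFunction.moebius nm.1 : ℚ) / (nm.1 : ℚ) * ((-1) ^ (nm.2 - 1) / (nm.2 : ℚ))) *
      map (Int.castRingHom ℚ) (pSym nm.1) ^ nm.2

section Characteristic

/-- The Frobenius characteristic `(1 / n!) ∑ s, Tr_V(s) p_s ∈ Λ ⊗ ℂ` of a complex representation
`V` of the group of permutations of a set with `n` elements, where `p_s` is the product of the
power sums `p_k` over the cycles of `s`, of lengths `k` (fixed points included). -/
def frobChar {α : Type*} [Fintype α] [DecidableEq α] {V : Type*} [AddCommGroup V] [Module ℂ V]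
    (ρ : Representation ℂ (Equiv.Perm α) V) : MvPolynomial ℕ ℂ :=
  C (1 / ((Fintype.card α).factorial : ℂ)) * ∑ s : Equiv.Perm α,
    C (LinearMap.trace ℂ V (ρ s)) *
      (s.partition.parts.map fun k => map (Int.castRingHom ℂ) (pSym k)).prod

/-- The one-dimensional representation given by a multiplicative character. -/
def charRep {G : Type*} [Monoid G] (χ : G →* ℂ) : Representation ℂ G ℂ :=
  ((algebraMap ℂ (Module.End ℂ ℂ) : ℂ →+* Module.End ℂ ℂ) : ℂ →* Module.End ℂ ℂ).comp χ

variable (n : ℕ) [NeZero n]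

/-- The inclusion of the cyclic group `C_n = ℤ/n` in the symmetric group `S_n` of permutations of
the `n`-element set `ℤ/n`: the generator `1` acts as the `n`-cycle `x ↦ x + 1`. -/
def cyclicIncl : Multiplicative (ZMod n) →* Equiv.Perm (ZMod n) where
  toFun c := Equiv.addRight c.toAdd
  map_one' := by ext x; simp
  map_mul' c d := by ext x; simp [add_comm, add_left_comm]

/-- The character `χ_n` of `C_n` equal to `e^{2πi/n}` on the generator. -/
def chiRep : Representation ℂ (Multiplicative (ZMod n)) ℂ :=
  charRep (ZMod.stdAddChar (N := n)).toMonoidHom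

/-- The sign representation `ε_n` of `S_n`. -/
def signRep : Representation ℂ (Equiv.Perm (ZMod n)) ℂ :=
  charRep ((Int.castRingHom ℂ : ℤ →* ℂ).comp ((Units.coeHom ℤ).comp Equiv.Perm.sign))

/-- The `S_n`-module `Ind_{C_n}^{S_n} χ_n ⊗ ε_n`. -/
def indChiSign : Representation ℂ (Equiv.Perm (ZMod n))
    (TensorProduct ℂ (Representation.IndV (cyclicIncl n) (chiRep n)) ℂ) :=
  (Representation.ind (cyclicIncl n) (chiRep n)).tprod (signRep n)

end Characteristic

end CompleteLambda

end

/-! The logarithm is built universally, inside `Λ`, before any ring `R` appears. Let `Exp` denote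
the sum of the `σ_k`, truncated and read modulo high weight. If `L` has order at least `m + 1`, then
`Exp(y + L)` and `Exp(y) + L` agree modulo order `m + 2` (`expSum_add`). Hence `Exp(ℓ) = 1 + h_1`
can be solved one degree at a time: the degree `n` part `ℓ_n = logSym n` is the error left by the
previous approximation. Nothing is divided, so `ℓ_n` lies in `Λ` by construction; what has to be
shown is that it equals `Log_n`.

For this, let `D` be the Euler derivation of `ℤ[x_1, …, x_N]`. On a monomial, `σ_t` is a geometric
series, so `D σ_t(y) = (∑ ψ_i(D y) t^i) σ_t(y)` holds for every `y`. Applied to `Exp(ℓ) = 1 + p_1`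
it gives `∑ ψ_i(D ℓ) = p_1 / (1 + p_1)`, whose degree `n` part is `∑_{ij = n} ψ_i(j ℓ_j) =
(-1)^(n-1) p_1^n`. Since `ψ_i ψ_j = ψ_{ij}`, Möbius inversion yields `n ℓ_n = ∑_{dm = n} μ(d)
(-1)^(m-1) p_d^m` (`nsmul_logSym`).

The Frobenius characteristic of the induced module reduces to an average over `C_n`. An element of
order `d` has `n/d` cycles of length `d`, and the values of `χ_n` on the elements of order `d` add
up to `μ(d)`, so the same sum appears.

In a `λ`-ring, `σ_k(g ∘ a) = (σ_k g) ∘ a` carries the identity `Exp(ℓ) = 1 + h_1` from `Λ` to `a`,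
and elements of weight at least `n` send `F 1` into `F n`. This gives convergence and `Exp(Log(1 +
a)) = 1 + a`. Injectivity of `Exp` follows again from `expSum_add`. Over `ℚ`, the literal formula is
a rearrangement of a double series. -/

noncomputable section

namespace CompleteLambda

open MvPolynomial

/-! ### Filtered pre-`λ`-rings and the truncated exponential -/

section Filtration

variable {R : Type*} [CommRing R]

/-- A decreasing multiplicative filtration of a pre-`λ`-ring, compatible with the operations. -/
structure IsFiltration (S : PreLambdaRing R) (F : ℕ → AddSubgroup R) : Prop where
  zero : F 0 = ⊤
  anti : Antitone F
  mul : ∀ m n a b, a ∈ F m → b ∈ F n → a * b ∈ F (m + n)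
  sigma : ∀ m n a, a ∈ F n → S.σ m a ∈ F (m * n)

lemma FilteredLambdaRing.isFiltration (S : FilteredLambdaRing R) :
    IsFiltration S.toPreLambdaRing S.F :=
  ⟨S.F_zero, S.F_antitone, S.F_mul, S.F_sigma⟩

/-- The partial sum `∑ k ≤ K, σ_k(a)`. -/
def PreLambdaRing.expSum (S : PreLambdaRing R) (K : ℕ) (a : R) : R :=
  ∑ k ∈ Finset.range (K + 1), S.σ k a

/-- The series `σ_t(0)` is idempotent with constant term `1`. In each degree from `2` on, the middle
terms of its square vanish by induction and `x = x + x` remains. -/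
lemma PreLambdaRing.sigma_zero_right (S : PreLambdaRing R) (k : ℕ) : S.σ (k + 1) 0 = 0 := by
  induction k using Nat.strong_induction_on with
  | _ k ih =>
    cases k with
    | zero => exact S.σ_one 0
    | succ k =>
      have h := S.σ_add (k + 2) 0 0
      rw [add_zero, Finset.Nat.sum_antidiagonal_succ, Finset.Nat.sum_antidiagonal_succ',
        Finset.sum_eq_zero] at h
      · simpa [S.σ_zero] using h
      · intro x hx
        have := Finset.HasAntidiagonal.mem_antidiagonal.mp hx
        simp only
        rw [ih x.1 (by omega), zero_mul]

namespace IsFiltration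

variable {S : PreLambdaRing R} {F : ℕ → AddSubgroup R}

lemma mem_zero (h : IsFiltration S F) (a : R) : a ∈ F 0 := by
  rw [h.zero]; trivial

lemma mul_mem_left (h : IsFiltration S F) {n : ℕ} (a : R) {b : R} (hb : b ∈ F n) :
    a * b ∈ F n := by
  simpa using h.mul 0 n a b (h.mem_zero a) hb

lemma pow_mem (h : IsFiltration S F) {n : ℕ} {b : R} (hb : b ∈ F n) (m : ℕ) :
    b ^ m ∈ F (n * m) := by
  induction m with
  | zero => exact h.mem_zero _
  | succ m ih => rw [pow_succ, Nat.mul_succ]; exact h.mul _ _ _ _ ih hb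

lemma prod_mem (h : IsFiltration S F) {ι : Type*} (s : Finset ι) (f : ι → R) (d : ι → ℕ)
    (hf : ∀ i ∈ s, f i ∈ F (d i)) : ∏ i ∈ s, f i ∈ F (∑ i ∈ s, d i) := by
  classical
  induction s using Finset.induction_on with
  | empty => exact h.mem_zero _
  | insert i s hi ih =>
    rw [Finset.prod_insert hi, Finset.sum_insert hi]
    exact h.mul _ _ _ _ (hf i (Finset.mem_insert_self i s))
      (ih fun j hj => hf j (Finset.mem_insert_of_mem hj))

lemma sigma_mem (h : IsFiltration S F) {n m k : ℕ} {a : R} (ha : a ∈ F n) (hk : k ≤ m * n) :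
    S.σ m a ∈ F k :=
  h.anti hk (h.sigma m n a ha)

lemma sigma_congr (h : IsFiltration S F) {k : ℕ} {x y : R} (hxy : x - y ∈ F k) (n : ℕ) :
    S.σ n x - S.σ n y ∈ F k := by
  cases n with
  | zero => simp [S.σ_zero, (F k).zero_mem]
  | succ n =>
    obtain ⟨d, rfl⟩ : ∃ d, x = y + d := ⟨x - y, by ring⟩
    rw [add_sub_cancel_left] at hxy
    rw [S.σ_add, Finset.Nat.sum_antidiagonal_succ', S.σ_zero, mul_one, add_sub_cancel_left]
    exact sum_mem fun p _ =>
      h.mul_mem_left _ (h.sigma_mem hxy (Nat.le_mul_of_pos_left k (Nat.succ_pos _)))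

lemma expSum_congr (h : IsFiltration S F) {k : ℕ} {x y : R} (hxy : x - y ∈ F k) (K : ℕ) :
    S.expSum K x - S.expSum K y ∈ F k := by
  rw [PreLambdaRing.expSum, PreLambdaRing.expSum, ← Finset.sum_sub_distrib]
  exact sum_mem fun n _ => h.sigma_congr hxy n

lemma expSum_sub_expSum (h : IsFiltration S F) {a : R} (ha : a ∈ F 1) {k K K' : ℕ}
    (hK : k ≤ K + 1) (hK' : K ≤ K') : S.expSum K' a - S.expSum K a ∈ F k := by
  rw [PreLambdaRing.expSum, PreLambdaRing.expSum, ← Finset.sum_range_add_sum_Ico _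
    (Nat.succ_le_succ hK'), add_sub_cancel_left]
  refine sum_mem fun n hn => h.sigma_mem ha ?_
  have := Finset.mem_Ico.mp hn
  omega

/-- The truncated exponential is `y + L ↦ (value at y) + L` up to terms of higher order. -/
lemma expSum_add (h : IsFiltration S F) {y L : R} {m : ℕ} (hy : y ∈ F 1) (hL : L ∈ F (m + 1))
    (K : ℕ) : S.expSum (K + 1) (y + L) - S.expSum (K + 1) y - L ∈ F (m + 2) := by
  -- The terms of degree `0` cancel and those of degree `1` differ by exactly `L`; only degrees at
  -- least `2` are left.
  have key : S.expSum (K + 1) (y + L) - S.expSum (K + 1) y - L =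
      ∑ k ∈ Finset.range K, (S.σ (k + 2) (y + L) - S.σ (k + 2) y) := by
    simp only [PreLambdaRing.expSum, Finset.sum_range_succ' _ (K + 1), Finset.sum_range_succ' _ K,
      S.σ_zero, zero_add, S.σ_one, Finset.sum_sub_distrib]
    ring
  rw [key]
  refine sum_mem fun k _ => ?_
  rw [S.σ_add, Finset.Nat.sum_antidiagonal_succ', S.σ_zero, mul_one, add_sub_cancel_left]
  refine sum_mem fun p hp => ?_
  have hp := Finset.HasAntidiagonal.mem_antidiagonal.mp hp
  have hm := h.mul _ _ _ _ (h.sigma p.1 1 y hy) (h.sigma (p.2 + 1) (m + 1) L hL)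
  -- The factor from `L` has index `p.2 + 1`. If `p.2 = 0`, the factor from `y` has positive index
  -- and adds at least `1` to `m + 1`; otherwise `2 (m + 1) ≥ m + 2` suffices.
  refine h.anti ?_ hm
  rcases Nat.eq_zero_or_pos p.2 with h0 | h0
  · simp only [h0]; omega
  · nlinarith

end IsFiltration

end Filtration

/-! ### Weight filtrations of polynomial rings -/

section Weights

variable {ι : Type*} (w : ι → ℕ)

/-- The polynomials all of whose monomials have weight at least `n`. -/
def lowFilt (n : ℕ) : AddSubgroup (MvPolynomial ι ℤ) where
  carrier := {f | ∀ m, Finsupp.weight w m < n → coeff m f = 0}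
  zero_mem' := fun m _ => coeff_zero m
  add_mem' := fun hf hg m hm => by rw [coeff_add, hf m hm, hg m hm, add_zero]
  neg_mem' := fun hf m hm => by rw [coeff_neg, hf m hm, neg_zero]

/-- The polynomials all of whose monomials have weight at most `n`. -/
def highFilt (n : ℕ) : AddSubgroup (MvPolynomial ι ℤ) where
  carrier := {f | ∀ m, n < Finsupp.weight w m → coeff m f = 0}
  zero_mem' := fun m _ => coeff_zero m
  add_mem' := fun hf hg m hm => by rw [coeff_add, hf m hm, hg m hm, add_zero]
  neg_mem' := fun hf m hm => by rw [coeff_neg, hf m hm, neg_zero]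

variable {w}

lemma mem_lowFilt {n : ℕ} {f : MvPolynomial ι ℤ} :
    f ∈ lowFilt w n ↔ ∀ m, Finsupp.weight w m < n → coeff m f = 0 := Iff.rfl

lemma lowFilt_zero : lowFilt w 0 = ⊤ := by
  ext f
  simp [mem_lowFilt]

lemma lowFilt_antitone : Antitone (lowFilt w) := fun _ _ hab _ hf m hm =>
  hf m (hm.trans_le hab)

lemma highFilt_monotone : Monotone (highFilt w) := fun _ _ hab _ hf m hm =>
  hf m (hab.trans_lt hm)

lemma lowFilt_mul {a b : ℕ} {f g : MvPolynomial ι ℤ} (hf : f ∈ lowFilt w a)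
    (hg : g ∈ lowFilt w b) : f * g ∈ lowFilt w (a + b) := by
  classical
  intro m hm
  rw [coeff_mul]
  refine Finset.sum_eq_zero fun p hp => ?_
  rw [← Finset.HasAntidiagonal.mem_antidiagonal.mp hp, map_add] at hm
  rcases lt_or_ge (Finsupp.weight w p.1) a with h | h
  · rw [hf _ h, zero_mul]
  · rw [hg _ (by omega), mul_zero]

lemma highFilt_mul {a b : ℕ} {f g : MvPolynomial ι ℤ} (hf : f ∈ highFilt w a)
    (hg : g ∈ highFilt w b) : f * g ∈ highFilt w (a + b) := by
  classical
  intro m hm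
  rw [coeff_mul]
  refine Finset.sum_eq_zero fun p hp => ?_
  rw [← Finset.HasAntidiagonal.mem_antidiagonal.mp hp, map_add] at hm
  rcases lt_or_ge a (Finsupp.weight w p.1) with h | h
  · rw [hf _ h, zero_mul]
  · rw [hg _ (by omega), mul_zero]

lemma monomial_mem_lowFilt {n : ℕ} {m : ι →₀ ℕ} {c : ℤ} (h : n ≤ Finsupp.weight w m) :
    monomial m c ∈ lowFilt w n := by
  classical
  intro m' hm'
  rw [coeff_monomial, if_neg]
  rintro rfl
  omega

lemma monomial_mem_highFilt {n : ℕ} {m : ι →₀ ℕ} {c : ℤ} (h : Finsupp.weight w m ≤ n) :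
    monomial m c ∈ highFilt w n := by
  classical
  intro m' hm'
  rw [coeff_monomial, if_neg]
  rintro rfl
  omega

lemma exists_mem_highFilt (f : MvPolynomial ι ℤ) : ∃ n, f ∈ highFilt w n := by
  refine ⟨f.support.sup (Finsupp.weight w), fun m hm => ?_⟩
  by_contra h
  exact absurd (Finset.le_sup (f := Finsupp.weight w) (mem_support_iff.mpr h)) (not_le.mpr hm)

lemma mem_lowFilt_of_isWeightedHomogeneous {n : ℕ} {f : MvPolynomial ι ℤ}
    (hf : IsWeightedHomogeneous w f n) : f ∈ lowFilt w n := fun m hm => by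
  by_contra h
  exact hm.ne (hf h)

lemma mem_highFilt_of_isWeightedHomogeneous {n : ℕ} {f : MvPolynomial ι ℤ}
    (hf : IsWeightedHomogeneous w f n) : f ∈ highFilt w n := fun m hm => by
  by_contra h
  exact hm.ne' (hf h)

lemma weightedHomogeneousComponent_of_mem_lowFilt {n k : ℕ} {f : MvPolynomial ι ℤ}
    (hf : f ∈ lowFilt w n) (hk : k < n) : weightedHomogeneousComponent w k f = 0 := by
  classical
  ext m
  rw [coeff_weightedHomogeneousComponent]
  split_ifs with h
  · rw [hf m (h ▸ hk), coeff_zero]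
  · rw [coeff_zero]

lemma mem_lowFilt_iff {n : ℕ} {f : MvPolynomial ι ℤ} :
    f ∈ lowFilt w n ↔ ∀ k < n, weightedHomogeneousComponent w k f = 0 := by
  classical
  refine ⟨fun h k hk => weightedHomogeneousComponent_of_mem_lowFilt h hk, fun h m hm => ?_⟩
  have := congrArg (coeff m) (h _ hm)
  rwa [coeff_weightedHomogeneousComponent, if_pos rfl, coeff_zero] at this

lemma sub_weightedHomogeneousComponent_mem_lowFilt {n : ℕ} {f : MvPolynomial ι ℤ}
    (hf : f ∈ lowFilt w n) : f - weightedHomogeneousComponent w n f ∈ lowFilt w (n + 1) := by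
  classical
  intro m hm
  rw [coeff_sub, coeff_weightedHomogeneousComponent]
  split_ifs with h
  · rw [sub_self]
  · rw [hf m (by omega), sub_zero]

lemma sum_weightedHomogeneousComponent_of_mem_highFilt {n : ℕ} {f : MvPolynomial ι ℤ}
    (hf : f ∈ highFilt w n) :
    ∑ k ∈ Finset.range (n + 1), weightedHomogeneousComponent w k f = f := by
  classical
  ext m
  rw [coeff_sum]
  simp only [coeff_weightedHomogeneousComponent, Finset.sum_ite_eq, Finset.mem_range]
  split_ifs with h
  · rfl
  · rw [hf m (by omega)]

/-- The degrees of the generators `h_{i+1}` of `Λ`. -/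
def wt (i : ℕ) : ℕ := i + 1

/-- A monomial `∏ h_{i+1}^{m_i}` acts on `a ∈ F 1` as `∏ σ_{i+1}(a)^{m_i}`, whose order is at least
the weight `∑ (i+1) m_i`. -/
lemma IsFiltration.act_mem {R : Type*} [CommRing R] {S : PreLambdaRing R}
    {F : ℕ → AddSubgroup R} (h : IsFiltration S F) {n : ℕ} {f : SymFun} (hf : f ∈ lowFilt wt n)
    {a : R} (ha : a ∈ F 1) : S.act f a ∈ F n := by
  rw [PreLambdaRing.act, aeval_eq_eval₂Hom, coe_eval₂Hom, eval₂_eq]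
  refine sum_mem fun m hm => ?_
  have hw : n ≤ ∑ i ∈ m.support, (i + 1) * m i := by
    by_contra hlt
    refine mem_support_iff.mp hm (hf m ?_)
    rw [Finsupp.weight_apply, Finsupp.sum]
    simpa [wt, mul_comm] using hlt
  exact h.mul_mem_left _ (h.anti hw (h.prod_mem _ _ _ fun i _ =>
    h.pow_mem (h.sigma_mem ha (mul_one _).ge) _))

end Weights

/-! ### The `σ`-operations and the Euler derivation on polynomial rings -/

section SigmaPolynomial

variable {ι κ : Type*}

/-- Monomials generate the additive group. Properties of `σ_t` stable under sums and negatives are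
therefore checked on monomials only, where `σ_t` is a geometric series. -/
lemma mem_of_monomial_mem (G : AddSubgroup (MvPolynomial ι ℤ)) (f : MvPolynomial ι ℤ)
    (h : ∀ m ∈ f.support, monomial m 1 ∈ G) : f ∈ G := by
  rw [← support_sum_monomial_coeff f]
  refine sum_mem fun m hm => ?_
  have : monomial m (coeff m f) = (coeff m f) • monomial m (1 : ℤ) := by simp [smul_monomial]
  rw [this]
  exact zsmul_mem (h m hm) _

lemma sigmaT_zero : sigmaT (0 : MvPolynomial ι ℤ) = 1 := by
  simp [sigmaT]

lemma sigmaT_neg (f : MvPolynomial ι ℤ) : sigmaT (-f) = (sigmaT f)⁻¹ := by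
  rw [eq_inv_iff_mul_eq_one, ← sigmaT_add, neg_add_cancel, sigmaT_zero]

lemma sigmaT_monomial (m : ι →₀ ℕ) : sigmaT (monomial m (1 : ℤ)) = geomUnit m := by
  classical
  simp [sigmaT, support_monomial]

lemma sigmaT_sum {α : Type*} (s : Finset α) (f : α → MvPolynomial ι ℤ) :
    sigmaT (∑ i ∈ s, f i) = ∏ i ∈ s, sigmaT (f i) := by
  classical
  induction s using Finset.induction_on with
  | empty => simp [sigmaT_zero]
  | insert i s hi ih => rw [Finset.sum_insert hi, Finset.prod_insert hi, sigmaT_add, ih]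

lemma coeff_sigmaT (f : MvPolynomial ι ℤ) (k : ℕ) :
    PowerSeries.coeff k (sigmaT f : PowerSeries (MvPolynomial ι ℤ)) = (polyPreLambda ι).σ k f :=
  rfl

lemma sigma_monomial (m : ι →₀ ℕ) (k : ℕ) :
    (polyPreLambda ι).σ k (monomial m 1) = monomial (k • m) 1 := by
  rw [← coeff_sigmaT, sigmaT_monomial]
  simp [geomUnit]

/-- This is the coefficient of `t^(k+1)` in `σ_t(a) σ_t(-a) = 1`, as a recursion for `σ(-a)`. -/
lemma PreLambdaRing.sigma_neg_succ {R : Type*} [CommRing R] (S : PreLambdaRing R) (k : ℕ) (a : R) :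
    S.σ (k + 1) (-a) = -∑ p ∈ Finset.HasAntidiagonal.antidiagonal k,
      S.σ (p.1 + 1) a * S.σ p.2 (-a) := by
  have h := S.σ_add (k + 1) a (-a)
  rw [add_neg_cancel, S.sigma_zero_right, Finset.Nat.sum_antidiagonal_succ] at h
  simp only [S.σ_zero, one_mul] at h
  linear_combination -h

/-- If the operations `σ_k` on all monomials of `f` lie in `A k`, so does `σ_k(f)`. -/
lemma sigma_mem_of_monomial_mem (A : ℕ → AddSubgroup (MvPolynomial ι ℤ)) (h1 : 1 ∈ A 0)
    (hmul : ∀ i j a b, a ∈ A i → b ∈ A j → a * b ∈ A (i + j)) (f : MvPolynomial ι ℤ)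
    (hf : ∀ m ∈ f.support, ∀ k, monomial (k • m) 1 ∈ A k) (k : ℕ) :
    (polyPreLambda ι).σ k f ∈ A k := by
  let G : AddSubgroup (MvPolynomial ι ℤ) :=
    { carrier := {f | ∀ k, (polyPreLambda ι).σ k f ∈ A k}
      zero_mem' := by
        intro k
        cases k with
        | zero => rw [(polyPreLambda ι).σ_zero]; exact h1
        | succ k => rw [(polyPreLambda ι).sigma_zero_right]; exact zero_mem _
      add_mem' := by
        intro a b ha hb k
        rw [(polyPreLambda ι).σ_add]
        refine sum_mem fun p hp => ?_
        rw [← Finset.HasAntidiagonal.mem_antidiagonal.mp hp]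
        exact hmul _ _ _ _ (ha _) (hb _)
      neg_mem' := by
        intro a ha k
        induction k using Nat.strong_induction_on with
        | _ k ih =>
          cases k with
          | zero => rw [(polyPreLambda ι).σ_zero]; exact h1
          | succ k =>
            rw [(polyPreLambda ι).sigma_neg_succ]
            refine neg_mem (sum_mem fun p hp => ?_)
            have hp := Finset.HasAntidiagonal.mem_antidiagonal.mp hp
            have : k + 1 = p.1 + 1 + p.2 := by omega
            rw [this]
            exact hmul _ _ _ _ (ha _) (ih _ (by omega)) }
  have : f ∈ G := mem_of_monomial_mem G f fun m hm k => by
    rw [sigma_monomial]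
    exact hf m hm k
  exact this k

lemma isFiltration_lowFilt (w : ι → ℕ) : IsFiltration (polyPreLambda ι) (lowFilt w) where
  zero := lowFilt_zero
  anti := lowFilt_antitone
  mul _ _ _ _ := lowFilt_mul
  sigma m n a ha := by
    refine sigma_mem_of_monomial_mem (fun k => lowFilt w (k * n)) ?_ ?_ a ?_ m
    · simp [lowFilt_zero]
    · intro i j a b h1 h2
      rw [add_mul]
      exact lowFilt_mul h1 h2
    · intro m hm k
      refine monomial_mem_lowFilt ?_
      rw [map_nsmul, smul_eq_mul]
      refine Nat.mul_le_mul_left k ?_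
      by_contra h
      exact mem_support_iff.mp hm (ha m (not_le.mp h))

lemma sigma_mem_highFilt {w : ι → ℕ} {n : ℕ} {f : MvPolynomial ι ℤ} (hf : f ∈ highFilt w n)
    (k : ℕ) : (polyPreLambda ι).σ k f ∈ highFilt w (k * n) := by
  refine sigma_mem_of_monomial_mem (fun k => highFilt w (k * n)) ?_ ?_ f ?_ k
  · exact monomial_mem_highFilt (by simp)
  · intro i j a b h1 h2
    rw [add_mul]
    exact highFilt_mul h1 h2
  · intro m hm k
    refine monomial_mem_highFilt ?_
    rw [map_nsmul, smul_eq_mul]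
    refine Nat.mul_le_mul_left k ?_
    by_contra h
    exact mem_support_iff.mp hm (hf m (not_le.mp h))

/-- Ring homomorphisms sending monomials to monomials or to zero commute with the operations. -/
lemma map_sigma (φ : MvPolynomial ι ℤ →ₐ[ℤ] MvPolynomial κ ℤ)
    (hφ : ∀ m, φ (monomial m 1) = 0 ∨ ∃ m', φ (monomial m 1) = monomial m' 1)
    (f : MvPolynomial ι ℤ) (k : ℕ) :
    φ ((polyPreLambda ι).σ k f) = (polyPreLambda κ).σ k (φ f) := by
  let Φ : (PowerSeries (MvPolynomial ι ℤ))ˣ →* (PowerSeries (MvPolynomial κ ℤ))ˣ :=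
    Units.map (PowerSeries.map (φ : MvPolynomial ι ℤ →+* MvPolynomial κ ℤ)).toMonoidHom
  let G : AddSubgroup (MvPolynomial ι ℤ) :=
    { carrier := {f | Φ (sigmaT f) = sigmaT (φ f)}
      zero_mem' := by simp [sigmaT_zero]
      add_mem' := by
        intro a b (ha : Φ _ = _) (hb : Φ _ = _)
        change Φ _ = _
        rw [sigmaT_add, map_mul, ha, hb, map_add, sigmaT_add]
      neg_mem' := by
        intro a (ha : Φ _ = _)
        change Φ _ = _
        rw [sigmaT_neg, map_inv, ha, map_neg, sigmaT_neg] }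
  have hG : f ∈ G := by
    refine mem_of_monomial_mem G f fun m _ => ?_
    change Φ _ = _
    have hpow : ∀ j : ℕ, φ (monomial (j • m) 1) = φ (monomial m 1) ^ j := fun j => by
      rw [← map_pow, monomial_pow, one_pow]
    refine Units.ext (PowerSeries.ext fun j => ?_)
    have e : PowerSeries.coeff j ((Φ (sigmaT (monomial m 1)) :
        (PowerSeries (MvPolynomial κ ℤ))ˣ) : PowerSeries (MvPolynomial κ ℤ)) =
        φ (monomial (j • m) 1) := by
      rw [← sigma_monomial]
      exact PowerSeries.coeff_map _ _ _
    rw [e, hpow, coeff_sigmaT]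
    rcases hφ m with h | ⟨m', h⟩
    · rw [h]
      cases j with
      | zero => rw [pow_zero, (polyPreLambda κ).σ_zero]
      | succ j => rw [(polyPreLambda κ).sigma_zero_right, zero_pow (Nat.succ_ne_zero j)]
    · rw [h, sigma_monomial, monomial_pow, one_pow]
  have := congrArg (fun u : (PowerSeries (MvPolynomial κ ℤ))ˣ =>
    PowerSeries.coeff k (u : PowerSeries (MvPolynomial κ ℤ))) (show Φ _ = _ from hG)
  rw [← coeff_sigmaT, ← coeff_sigmaT, ← this]
  exact (PowerSeries.coeff_map _ _ _).symm

lemma rename_sigma (e : ι → κ) (f : MvPolynomial ι ℤ) (k : ℕ) :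
    rename e ((polyPreLambda ι).σ k f) = (polyPreLambda κ).σ k (rename e f) :=
  map_sigma (rename e) (fun m => Or.inr ⟨m.mapDomain e, rename_monomial e m 1⟩) f k

/-- Setting the variables outside the range of an injection to zero. -/
lemma killCompl_sigma {e : ι → κ} (he : Function.Injective e) (f : MvPolynomial κ ℤ) (k : ℕ) :
    killCompl he ((polyPreLambda κ).σ k f) = (polyPreLambda ι).σ k (killCompl he f) := by
  refine map_sigma (killCompl he) (fun m => ?_) f k
  by_cases h : (m.support : Set κ) ⊆ Set.range e
  · exact Or.inr ⟨_, killCompl_monomial_eq_monomial_comapDomain_of_subset he 1 h⟩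
  · exact Or.inl (killCompl_monomial_eq_zero_of_not_subset he 1 h)

/-- The Euler derivation, multiplying each monomial by its degree. -/
def euler : Derivation ℤ (MvPolynomial ι ℤ) (MvPolynomial ι ℤ) := mkDerivation ℤ X

lemma euler_monomial (m : ι →₀ ℕ) (c : ℤ) :
    euler (monomial m c) = Finsupp.weight (1 : ι → ℕ) m • monomial m c := by
  classical
  rw [euler, mkDerivation_monomial, Finsupp.weight_apply, Finsupp.sum, Finsupp.sum,
    Finset.smul_sum, Finset.sum_smul]
  refine Finset.sum_congr rfl fun i hi => ?_
  have hle : Finsupp.single i 1 ≤ m := by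
    rw [Finsupp.single_le_iff]
    exact Nat.one_le_iff_ne_zero.mpr (Finsupp.mem_support_iff.mp hi)
  rw [X, smul_eq_mul, monomial_mul, tsub_add_cancel_of_le hle, smul_monomial, mul_one]
  simp [smul_monomial, mul_comm]

lemma coeff_euler (f : MvPolynomial ι ℤ) (m : ι →₀ ℕ) :
    coeff m (euler f) = Finsupp.weight (1 : ι → ℕ) m * coeff m f := by
  classical
  induction f using MvPolynomial.induction_on' with
  | monomial m' b =>
    rw [euler_monomial, coeff_smul, coeff_monomial]
    split_ifs with h
    · rw [h, nsmul_eq_mul]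
    · simp
  | add p q hp hq => rw [map_add, coeff_add, coeff_add, hp, hq, mul_add]

lemma euler_of_isWeightedHomogeneous {f : MvPolynomial ι ℤ} {n : ℕ}
    (hf : IsWeightedHomogeneous (1 : ι → ℕ) f n) : euler f = n • f := by
  ext m
  rw [coeff_euler, coeff_smul, nsmul_eq_mul]
  by_cases h : coeff m f = 0
  · simp [h]
  · rw [hf h]

lemma euler_mem_lowFilt {f : MvPolynomial ι ℤ} {n : ℕ} (hf : f ∈ lowFilt (1 : ι → ℕ) n) :
    euler f ∈ lowFilt (1 : ι → ℕ) n := fun m hm => by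
  rw [coeff_euler, hf m hm, mul_zero]

lemma isWeightedHomogeneous_expand {w : ι → ℕ} {f : MvPolynomial ι ℤ} {n : ℕ}
    (hf : IsWeightedHomogeneous w f n) (d : ℕ) : IsWeightedHomogeneous w (expand d f) (d * n) := by
  rw [← support_sum_monomial_coeff f, map_sum]
  refine IsWeightedHomogeneous.sum _ _ _ fun m hm => ?_
  rw [expand_monomial]
  refine isWeightedHomogeneous_monomial _ _ _ ?_
  rw [map_nsmul, hf (mem_support_iff.mp hm), smul_eq_mul]

lemma expand_mem_lowFilt {w : ι → ℕ} {f : MvPolynomial ι ℤ} {n : ℕ} (hf : f ∈ lowFilt w n)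
    (d : ℕ) : expand d f ∈ lowFilt w (d * n) := by
  rw [← support_sum_monomial_coeff f, map_sum]
  refine sum_mem fun m hm => ?_
  rw [expand_monomial]
  refine monomial_mem_lowFilt ?_
  rw [map_nsmul, smul_eq_mul]
  refine Nat.mul_le_mul_left d ?_
  by_contra h
  exact mem_support_iff.mp hm (hf m (not_le.mp h))

/-- The Euler derivation, applied to the coefficients of a power series. -/
def eulerT (f : PowerSeries (MvPolynomial ι ℤ)) : PowerSeries (MvPolynomial ι ℤ) :=
  PowerSeries.mk fun n => euler (PowerSeries.coeff n f)

lemma eulerT_mul (f g : PowerSeries (MvPolynomial ι ℤ)) :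
    eulerT (f * g) = eulerT f * g + f * eulerT g := by
  ext1 n
  simp only [eulerT, PowerSeries.coeff_mk, PowerSeries.coeff_mul, map_add, map_sum,
    Derivation.leibniz, smul_eq_mul, ← Finset.sum_add_distrib]
  exact Finset.sum_congr rfl fun p _ => by ring

lemma eulerT_one : eulerT (1 : PowerSeries (MvPolynomial ι ℤ)) = 0 := by
  ext1 n
  rw [eulerT, PowerSeries.coeff_mk, PowerSeries.coeff_one]
  split_ifs <;> simp

/-- The series `∑ i ≥ 1, ψ_i(D y) t^i`, where `D` is the Euler derivation. -/
def eulerAdams (y : MvPolynomial ι ℤ) : PowerSeries (MvPolynomial ι ℤ) :=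
  PowerSeries.mk fun i => if i = 0 then 0 else expand i (euler y)

lemma eulerAdams_add (y z : MvPolynomial ι ℤ) :
    eulerAdams (y + z) = eulerAdams y + eulerAdams z := by
  ext1 n
  simp only [eulerAdams, PowerSeries.coeff_mk, map_add]
  split_ifs <;> simp

lemma eulerAdams_zero : eulerAdams (0 : MvPolynomial ι ℤ) = 0 := by
  ext1 n
  simp [eulerAdams]

/-- The logarithmic derivative of `σ_t(y)` along the Euler derivation. -/
lemma eulerT_sigmaT (y : MvPolynomial ι ℤ) :
    eulerT (sigmaT y : PowerSeries (MvPolynomial ι ℤ)) =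
      eulerAdams y * (sigmaT y : PowerSeries (MvPolynomial ι ℤ)) := by
  let G : AddSubgroup (MvPolynomial ι ℤ) :=
    { carrier := {y | eulerT (sigmaT y : PowerSeries (MvPolynomial ι ℤ)) =
        eulerAdams y * (sigmaT y : PowerSeries (MvPolynomial ι ℤ))}
      zero_mem' := by simp [sigmaT_zero, eulerT_one, eulerAdams_zero]
      add_mem' := by
        intro a b (ha : _ = _) (hb : _ = _)
        change _ = _
        rw [sigmaT_add, Units.val_mul, eulerT_mul, ha, hb, eulerAdams_add]
        ring
      neg_mem' := by
        intro a (ha : _ = _)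
        change _ = _
        have h1 : (sigmaT a : PowerSeries (MvPolynomial ι ℤ)) *
            (sigmaT (-a) : PowerSeries (MvPolynomial ι ℤ)) = 1 := by
          rw [sigmaT_neg, Units.mul_inv]
        -- Differentiating `σ_t(a) σ_t(-a) = 1` and multiplying by `σ_t(-a)` isolates the derivative
        -- of `σ_t(-a)`.
        have h2 := congrArg eulerT h1
        rw [eulerT_mul, eulerT_one, ha] at h2
        have h3 : eulerAdams (-a) = -eulerAdams a := by
          rw [eq_neg_iff_add_eq_zero, ← eulerAdams_add, neg_add_cancel, eulerAdams_zero]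
        rw [h3]
        linear_combination (sigmaT (-a) : PowerSeries (MvPolynomial ι ℤ)) * h2 -
          (eulerT (sigmaT (-a) : PowerSeries (MvPolynomial ι ℤ)) + eulerAdams a *
            (sigmaT (-a) : PowerSeries (MvPolynomial ι ℤ))) * h1 }
  have : y ∈ G := by
    refine mem_of_monomial_mem G y fun m _ => ?_
    change _ = _
    ext1 k
    rw [eulerT, PowerSeries.coeff_mk, coeff_sigmaT, sigma_monomial, euler_monomial,
      PowerSeries.coeff_mul]
    cases k with
    | zero => simp [eulerAdams]
    | succ k =>
      rw [Finset.Nat.sum_antidiagonal_succ]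
      -- Each of the `k + 1` products with positive Adams index equals `|m| x^((k+1) m)`, where
      -- `|m|` is the degree of `x^m`; together they give the degree `(k + 1) |m|` by which `D`
      -- multiplies the left side.
      have : ∀ p ∈ Finset.HasAntidiagonal.antidiagonal k,
          PowerSeries.coeff (p.1 + 1) (eulerAdams (monomial m (1 : ℤ))) *
          PowerSeries.coeff p.2 (sigmaT (monomial m (1 : ℤ)) : PowerSeries (MvPolynomial ι ℤ)) =
          Finsupp.weight (1 : ι → ℕ) m • monomial ((k + 1) • m) (1 : ℤ) := by
        intro p hp
        have hp := Finset.HasAntidiagonal.mem_antidiagonal.mp hp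
        rw [coeff_sigmaT, sigma_monomial, eulerAdams, PowerSeries.coeff_mk,
          if_neg (Nat.succ_ne_zero _), euler_monomial, map_nsmul, expand_monomial, smul_mul_assoc,
          monomial_mul, ← add_smul, one_mul]
        congr 4
        omega
      rw [Finset.sum_congr rfl this, Finset.sum_const, Finset.Nat.card_antidiagonal, map_nsmul,
        smul_smul]
      simp [eulerAdams, smul_eq_mul]
  exact this

lemma euler_sigma (y : MvPolynomial ι ℤ) (k : ℕ) :
    euler ((polyPreLambda ι).σ k y) = ∑ p ∈ Finset.HasAntidiagonal.antidiagonal k,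
      (if p.1 = 0 then 0 else expand p.1 (euler y)) * (polyPreLambda ι).σ p.2 y := by
  have h := congrArg (PowerSeries.coeff k) (eulerT_sigmaT y)
  rw [PowerSeries.coeff_mul] at h
  simp only [eulerT, eulerAdams, PowerSeries.coeff_mk] at h
  exact h

end SigmaPolynomial

/-! ### Realization of `Λ` by symmetric polynomials -/

section Realization

variable {σ : Type*} [Fintype σ]

lemma coeff_prod_one_add_X (n : ℕ) :
    PowerSeries.coeff n (∏ i : σ, (1 + PowerSeries.C (X i : MvPolynomial σ ℤ) * PowerSeries.X)) =
      esymm σ ℤ n := by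
  classical
  rw [Finset.prod_one_add, map_sum, esymm, Finset.powersetCard_eq_filter, Finset.sum_filter]
  refine Finset.sum_congr rfl fun t _ => ?_
  rw [Finset.prod_mul_distrib, Finset.prod_const, ← map_prod, PowerSeries.coeff_C_mul,
    PowerSeries.coeff_X_pow]
  split_ifs with h1 h2 h2
  · rw [mul_one]
  · exact absurd h1.symm h2
  · exact absurd h2.symm h1
  · rw [mul_zero]

variable [DecidableEq σ]

/-- Both sides are the degree `k` coefficient of `∏ (1 - t x_i)⁻¹`. Multisets of size `k` correspond
to exponent vectors of total `k`. -/
lemma sigma_sum_X (k : ℕ) :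
    (polyPreLambda σ).σ k (∑ i, X i) = hsymm σ ℤ k := by
  rw [← coeff_sigmaT, sigmaT_sum]
  have h1 : ((∏ i : σ, sigmaT (X i : MvPolynomial σ ℤ) :
      (PowerSeries (MvPolynomial σ ℤ))ˣ) : PowerSeries (MvPolynomial σ ℤ)) =
      ∏ i : σ, (geomUnit (Finsupp.single i 1) : PowerSeries (MvPolynomial σ ℤ)) := by
    rw [Units.coe_prod]
    exact Finset.prod_congr rfl fun i _ => by rw [X, sigmaT_monomial]
  rw [h1, PowerSeries.coeff_prod, hsymm]
  symm
  refine Finset.sum_bij (fun s _ => Multiset.toFinsupp s.1) ?_ ?_ ?_ ?_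
  · intro s _
    rw [Finset.mem_finsuppAntidiag]
    refine ⟨?_, Finset.subset_univ _⟩
    change ∑ i, Multiset.count i s.1 = k
    rw [Multiset.sum_count_eq_card fun a _ => Finset.mem_univ a]
    exact s.2
  · intro s _ t _ h
    exact Subtype.ext (Multiset.toFinsupp.injective h)
  · intro l hl
    rw [Finset.mem_finsuppAntidiag] at hl
    refine ⟨⟨Finsupp.toMultiset l, ?_⟩, Finset.mem_univ _, ?_⟩
    · rw [Finsupp.card_toMultiset, Finsupp.sum_fintype _ _ fun _ => rfl]
      exact hl.1
    · exact Finsupp.toMultiset_toFinsupp l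
  · intro s _
    rw [Finset.prod_multiset_map_count, Finset.prod_subset (Finset.subset_univ _)]
    · refine Finset.prod_congr rfl fun i _ => ?_
      simp [geomUnit, X_pow_eq_monomial]
    · intro i _ hi
      rw [Multiset.mem_toFinset] at hi
      rw [Multiset.count_eq_zero_of_notMem hi, pow_zero]

end Realization

/-- The generating series `H(t)` of the complete symmetric functions. -/
def hSeries : PowerSeries SymFun := PowerSeries.mk hSym

/-- The generating series `E(t) = H(-t)⁻¹` of the elementary symmetric functions. -/
def eSeries : PowerSeries SymFun :=
  PowerSeries.evalNegHom (PowerSeries.invOfUnit hSeries 1)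

lemma evalNegHom_evalNegHom {A : Type*} [CommRing A] (f : PowerSeries A) :
    PowerSeries.evalNegHom (PowerSeries.evalNegHom f) = f := by
  ext n
  simp only [PowerSeries.evalNegHom, PowerSeries.coeff_rescale, ← mul_assoc, ← mul_pow]
  simp

lemma map_evalNegHom {A B : Type*} [CommRing A] [CommRing B] (φ : A →+* B) (f : PowerSeries A) :
    PowerSeries.map φ (PowerSeries.evalNegHom f) =
      PowerSeries.evalNegHom (PowerSeries.map φ f) := by
  ext n
  simp [PowerSeries.evalNegHom, PowerSeries.coeff_rescale]

lemma hSeries_mul_eSeries : hSeries * PowerSeries.evalNegHom eSeries = 1 := by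
  rw [eSeries, evalNegHom_evalNegHom]
  refine PowerSeries.mul_invOfUnit _ _ ?_
  simp [hSeries, hSym]

lemma constantCoeff_eSeries : PowerSeries.coeff 0 eSeries = 1 := by
  simp [eSeries, PowerSeries.evalNegHom, PowerSeries.coeff_rescale]

/-- The involution of `Λ` exchanging complete and elementary symmetric functions. -/
def omega : SymFun →ₐ[ℤ] SymFun := aeval fun n => PowerSeries.coeff (n + 1) eSeries

lemma map_omega_hSeries : PowerSeries.map (omega : SymFun →+* SymFun) hSeries = eSeries := by
  ext1 n
  rw [PowerSeries.coeff_map, hSeries, PowerSeries.coeff_mk]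
  cases n with
  | zero => rw [hSym, map_one, constantCoeff_eSeries]
  | succ n => exact aeval_X _ _

/-- Applying `omega` to `H(t) E(-t) = 1` and replacing `t` by `-t` shows that the image of `E(t)` is
inverse to `E(-t)`, as is `H(t)`. -/
lemma map_omega_eSeries : PowerSeries.map (omega : SymFun →+* SymFun) eSeries = hSeries := by
  have h1 := congrArg (PowerSeries.map (omega : SymFun →+* SymFun)) hSeries_mul_eSeries
  rw [map_mul, map_one, map_evalNegHom, map_omega_hSeries] at h1
  have h2 := congrArg PowerSeries.evalNegHom h1
  rw [map_mul, map_one, evalNegHom_evalNegHom] at h2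
  linear_combination hSeries * h2 -
    (PowerSeries.map (omega : SymFun →+* SymFun) eSeries) * hSeries_mul_eSeries

lemma omega_omega (f : SymFun) : omega (omega f) = f := by
  have : omega.comp omega = AlgHom.id ℤ SymFun := by
    refine algHom_ext fun n => ?_
    have h1 := congrArg (PowerSeries.coeff (n + 1)) map_omega_eSeries
    rw [PowerSeries.coeff_map, hSeries, PowerSeries.coeff_mk] at h1
    rw [AlgHom.comp_apply]
    nth_rewrite 2 [omega]
    rw [aeval_X]
    exact h1
  exact DFunLike.congr_fun this f

lemma toVars_hSym (N k : ℕ) : toVars N (hSym k) = hsymm (Fin N) ℤ k := by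
  cases k with
  | zero => rw [hSym, map_one, hsymm_zero]
  | succ k => rw [hSym, toVars, aeval_X]

lemma map_toVars_hSeries (N : ℕ) :
    PowerSeries.map (toVars N : SymFun →+* MvPolynomial (Fin N) ℤ) hSeries =
      (sigmaT (∑ i : Fin N, X i) : PowerSeries (MvPolynomial (Fin N) ℤ)) := by
  ext1 k
  rw [PowerSeries.coeff_map, hSeries, PowerSeries.coeff_mk, coeff_sigmaT, sigma_sum_X]
  exact toVars_hSym N k

lemma toVars_coeff_eSeries (N n : ℕ) :
    toVars N (PowerSeries.coeff n eSeries) = esymm (Fin N) ℤ n := by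
  have h1 := congrArg (PowerSeries.map (toVars N : SymFun →+* MvPolynomial (Fin N) ℤ))
    hSeries_mul_eSeries
  rw [map_mul, map_one, map_toVars_hSeries, map_evalNegHom, sigmaT_sum] at h1
  have h2 := Units.mul_eq_one_iff_inv_eq.mp h1
  have h3 : PowerSeries.map (toVars N : SymFun →+* MvPolynomial (Fin N) ℤ) eSeries =
      ∏ i : Fin N, (1 + PowerSeries.C (X i : MvPolynomial (Fin N) ℤ) * PowerSeries.X) := by
    rw [← evalNegHom_evalNegHom (PowerSeries.map _ eSeries), ← h2, ← Finset.prod_inv_distrib,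
      Units.coe_prod, map_prod]
    refine Finset.prod_congr rfl fun i _ => ?_
    rw [X, sigmaT_monomial]
    change PowerSeries.evalNegHom (1 - PowerSeries.C _ * PowerSeries.X) = _
    rw [map_sub, map_one, map_mul, PowerSeries.evalNegHom_X]
    have : PowerSeries.evalNegHom (PowerSeries.C (monomial (Finsupp.single i 1) (1 : ℤ))) =
        PowerSeries.C (monomial (Finsupp.single i 1) (1 : ℤ)) := by
      ext1 n
      rw [PowerSeries.evalNegHom, PowerSeries.coeff_rescale, PowerSeries.coeff_C]
      split_ifs with h <;> simp [h]
    rw [this, mul_neg, sub_neg_eq_add]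
  rw [← coeff_prod_one_add_X, ← h3, PowerSeries.coeff_map]
  rfl

lemma toVars_omega (N : ℕ) (f : SymFun) :
    toVars N (omega f) = aeval (fun n => esymm (Fin N) ℤ (n + 1)) f := by
  have : (toVars N).comp omega = aeval fun n => esymm (Fin N) ℤ (n + 1) := by
    refine algHom_ext fun n => ?_
    rw [AlgHom.comp_apply, omega, aeval_X, aeval_X, toVars_coeff_eSeries]
  exact DFunLike.congr_fun this f

/-- The bridge to the fundamental theorem on symmetric polynomials: `esymmAlgHom` uses elementary
generators, while `Λ` is generated by complete ones, and `omega` exchanges the two. -/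
lemma toVars_omega_rename (N : ℕ) (q : MvPolynomial (Fin N) ℤ) :
    toVars N (omega (rename Fin.val q)) = (esymmAlgHom (Fin N) ℤ N q).1 := by
  rw [toVars_omega, aeval_rename, esymmAlgHom_apply]
  rfl

lemma exists_toVars_eq {N : ℕ} {f : MvPolynomial (Fin N) ℤ} (hf : f.IsSymmetric) :
    ∃ k : SymFun, toVars N k = f := by
  obtain ⟨q, hq⟩ := (esymmAlgHom_fin_bijective ℤ N).2 ⟨f, hf⟩
  exact ⟨omega (rename Fin.val q), by rw [toVars_omega_rename, hq]⟩

lemma eq_zero_of_toVars_eq_zero {f : SymFun} (hf : ∀ N, toVars N f = 0) : f = 0 := by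
  rw [← omega_omega f]
  -- Only finitely many generators occur in `omega f`; in that many variables the elementary
  -- symmetric polynomials realizing them are algebraically independent.
  obtain ⟨N, hN⟩ : ∃ N, ∀ i ∈ (omega f).vars, i < N :=
    ⟨(omega f).vars.sup id + 1, fun i hi => Nat.lt_succ_of_le (Finset.le_sup (f := id) hi)⟩
  obtain ⟨q, hq⟩ := exists_rename_eq_of_vars_subset_range (omega f) (Fin.val : Fin N → ℕ)
    Fin.val_injective fun i hi => ⟨⟨i, hN i hi⟩, rfl⟩
  have h1 : esymmAlgHom (Fin N) ℤ N q = 0 := by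
    refine Subtype.ext ?_
    rw [← toVars_omega_rename, hq, omega_omega]
    exact hf N
  have h2 : q = 0 := esymmAlgHom_fin_injective ℤ le_rfl (h1.trans (map_zero _).symm)
  rw [← hq, h2, map_zero, map_zero]

lemma toVars_ext {f g : SymFun} (h : ∀ N, toVars N f = toVars N g) : f = g := by
  rw [← sub_eq_zero]
  exact eq_zero_of_toVars_eq_zero fun N => by rw [map_sub, h N, sub_self]

lemma isWeightedHomogeneous_hsymm (N n : ℕ) :
    IsWeightedHomogeneous (1 : Fin N → ℕ) (hsymm (Fin N) ℤ n) n := by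
  refine IsWeightedHomogeneous.sum _ _ _ fun s _ => ?_
  have : ∀ m : Multiset (Fin N), IsWeightedHomogeneous (1 : Fin N → ℕ)
      (m.map (X : Fin N → MvPolynomial (Fin N) ℤ)).prod m.card := by
    intro m
    induction m using Multiset.induction_on with
    | empty => simpa using isWeightedHomogeneous_one ℤ _
    | cons a m ih =>
      rw [Multiset.map_cons, Multiset.prod_cons, Multiset.card_cons, add_comm]
      exact (isWeightedHomogeneous_X ℤ (1 : Fin N → ℕ) a).mul ih
  have := this s.1
  rwa [s.2] at this

lemma isWeightedHomogeneous_toVars_monomial (N : ℕ) (m : ℕ →₀ ℕ) (c : ℤ) :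
    IsWeightedHomogeneous (1 : Fin N → ℕ) (toVars N (monomial m c)) (Finsupp.weight wt m) := by
  rw [toVars, aeval_monomial, Finsupp.weight_apply]
  refine IsWeightedHomogeneous.C_mul (IsWeightedHomogeneous.prod _ _ _ fun i _ => ?_) c
  have := (isWeightedHomogeneous_hsymm N (i + 1)).pow (m i)
  exact this

lemma toVars_weightedHomogeneousComponent (N n : ℕ) (f : SymFun) :
    toVars N (weightedHomogeneousComponent wt n f) =
      weightedHomogeneousComponent (1 : Fin N → ℕ) n (toVars N f) := by
  induction f using MvPolynomial.induction_on' with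
  | monomial m c =>
    rw [weightedHomogeneousComponent_of_mem (isWeightedHomogeneous_monomial wt m c rfl),
      weightedHomogeneousComponent_of_mem (isWeightedHomogeneous_toVars_monomial N m c)]
    split_ifs
    · rfl
    · exact map_zero _
  | add p q hp hq => simp only [map_add, hp, hq]

/-- Realizations commute with taking homogeneous components and are jointly injective, so weight in
`Λ` can be tested as ordinary degree in every number of variables. -/
lemma mem_lowFilt_wt_iff {n : ℕ} {f : SymFun} :
    f ∈ lowFilt wt n ↔ ∀ N, toVars N f ∈ lowFilt (1 : Fin N → ℕ) n := by
  simp only [mem_lowFilt_iff, ← toVars_weightedHomogeneousComponent]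
  refine ⟨fun h N k hk => by rw [h k hk, map_zero], fun h k hk => ?_⟩
  exact eq_zero_of_toVars_eq_zero fun N => h N k hk

lemma toVars_mem_highFilt {n : ℕ} {f : SymFun} (hf : f ∈ highFilt wt n) (N : ℕ) :
    toVars N f ∈ highFilt (1 : Fin N → ℕ) n := by
  rw [← sum_weightedHomogeneousComponent_of_mem_highFilt hf, map_sum]
  refine sum_mem fun k hk => ?_
  rw [toVars_weightedHomogeneousComponent]
  exact highFilt_monotone (Nat.lt_succ_iff.mp (Finset.mem_range.mp hk))
    (mem_highFilt_of_isWeightedHomogeneous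
      (weightedHomogeneousComponent_isWeightedHomogeneous k _))

/-! ### Stability in the number of variables, and plethysm -/

section KillCompl

variable {ι κ : Type*}

lemma killCompl_hsymm [Fintype ι] [Fintype κ] [DecidableEq ι] [DecidableEq κ] {e : ι → κ}
    (he : Function.Injective e) (k : ℕ) : killCompl he (hsymm κ ℤ k) = hsymm ι ℤ k := by
  rw [← sigma_sum_X, killCompl_sigma, ← sigma_sum_X]
  congr 1
  rw [map_sum]
  have h1 : ∀ j ∉ Finset.univ.map ⟨e, he⟩, killCompl he (X j : MvPolynomial κ ℤ) = 0 := by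
    intro j hj
    rw [killCompl, aeval_X, dif_neg]
    rintro ⟨i, rfl⟩
    exact hj (Finset.mem_map_of_mem _ (Finset.mem_univ i))
  rw [← Finset.sum_subset (Finset.subset_univ (Finset.univ.map ⟨e, he⟩)) fun j _ hj => h1 j hj,
    Finset.sum_map]
  refine Finset.sum_congr rfl fun i _ => ?_
  change killCompl he (X (e i)) = X i
  rw [← rename_X (R := ℤ) e i, killCompl_rename_app]

lemma killCompl_toVars {M N : ℕ} {e : Fin M → Fin N} (he : Function.Injective e) (f : SymFun) :
    killCompl he (toVars N f) = toVars M f := by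
  have : (killCompl he).comp (toVars N) = toVars M := by
    refine algHom_ext fun n => ?_
    rw [AlgHom.comp_apply, toVars, aeval_X, toVars, aeval_X, killCompl_hsymm]
  exact DFunLike.congr_fun this f

/-- A symmetric polynomial is determined by its restriction to at least as many variables as its
degree. -/
lemma eq_zero_of_killCompl_eq_zero {D N : ℕ} {e : Fin D → Fin N} (he : Function.Injective e)
    {f : MvPolynomial (Fin N) ℤ} (hf : f.IsSymmetric) (hD : f ∈ highFilt (1 : Fin N → ℕ) D)
    (h0 : killCompl he f = 0) : f = 0 := by
  classical
  ext m
  rw [coeff_zero]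
  by_contra hm
  have hw : Finsupp.weight (1 : Fin N → ℕ) m ≤ D := by
    by_contra h
    exact hm (hD m (not_le.mp h))
  have hcard : m.support.card ≤ D := by
    refine le_trans ?_ hw
    rw [Finsupp.weight_apply, Finsupp.sum, Finset.card_eq_sum_ones]
    refine Finset.sum_le_sum fun i hi => ?_
    simpa [Nat.one_le_iff_ne_zero] using hi
  obtain ⟨T, hT, hTc⟩ := Finset.exists_subset_card_eq
    (s := Finset.univ.map ⟨e, he⟩) (n := m.support.card) (by simpa using hcard)
  -- A monomial of degree at most `D` involves at most `D` variables. A permutation moves them into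
  -- the range of `e`; by symmetry the coefficient is unchanged, and it survives the restriction.
  let π : Equiv.Perm (Fin N) := Equiv.extendSubtype (p := (· ∈ m.support)) (q := (· ∈ T))
    (Finset.equivOfCardEq hTc.symm)
  have hπ : ∀ i ∈ m.support, π i ∈ T := fun i hi =>
    Equiv.extendSubtype_mem (p := (· ∈ m.support)) (q := (· ∈ T))
      (Finset.equivOfCardEq hTc.symm) i hi
  have h1 : coeff (m.mapDomain π) f = coeff m f := by
    rw [← coeff_rename_mapDomain π π.injective f m, hf π]
  obtain ⟨m', hm'⟩ : ∃ m' : Fin D →₀ ℕ, m'.mapDomain e = m.mapDomain π := by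
    refine ⟨(m.mapDomain π).comapDomain e he.injOn, Finsupp.mapDomain_comapDomain e he _ ?_⟩
    intro j hj
    obtain ⟨i, hi, rfl⟩ := Finset.mem_image.mp (Finsupp.mapDomain_support hj)
    obtain ⟨d, -, hd⟩ := Finset.mem_map.mp (hT (hπ i hi))
    exact ⟨d, hd⟩
  have h2 := coeff_killCompl he (p := f) (s := m')
  rw [h0, coeff_zero, hm', h1] at h2
  exact hm h2.symm

end KillCompl

lemma isSymmetric_toVars (N : ℕ) (f : SymFun) : (toVars N f).IsSymmetric := by
  intro e
  have : (rename e).comp (toVars N) = toVars N := by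
    refine algHom_ext fun n => ?_
    rw [AlgHom.comp_apply, toVars, aeval_X, rename_hsymm]
  exact DFunLike.congr_fun this f

/-- If `g` has weight at most `d`, then `σ_k` of its realizations has degree at most `D = k d`. A
lift from `D` variables thus determines the element in any number of variables: fewer by
restriction, more because degree at most `D` is detected in `D` variables. -/
lemma exists_plethysm (k : ℕ) (g : SymFun) :
    ∃ p : SymFun, ∀ N, toVars N p = (polyPreLambda (Fin N)).σ k (toVars N g) := by
  obtain ⟨d, hd⟩ := exists_mem_highFilt (w := wt) g
  set D := k * d with hD
  have hG : ∀ N, (polyPreLambda (Fin N)).σ k (toVars N g) ∈ highFilt (1 : Fin N → ℕ) D :=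
    fun N => sigma_mem_highFilt (toVars_mem_highFilt hd N) k
  have hs : ∀ N, ((polyPreLambda (Fin N)).σ k (toVars N g)).IsSymmetric := fun N e => by
    rw [rename_sigma, isSymmetric_toVars N g e]
  obtain ⟨q, hq⟩ := exists_toVars_eq (hs D)
  -- The lift `q` may contain components of weight above `D` that vanish in `D` variables but not in
  -- more; they are cut off.
  set p := ∑ j ∈ Finset.range (D + 1), weightedHomogeneousComponent wt j q with hp
  have hpD : toVars D p = (polyPreLambda (Fin D)).σ k (toVars D g) := by
    rw [hp, map_sum]
    simp only [toVars_weightedHomogeneousComponent, hq]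
    exact sum_weightedHomogeneousComponent_of_mem_highFilt (hG D)
  have hph : p ∈ highFilt wt D := sum_mem fun j hj =>
    highFilt_monotone (Nat.lt_succ_iff.mp (Finset.mem_range.mp hj))
      (mem_highFilt_of_isWeightedHomogeneous (weightedHomogeneousComponent_isWeightedHomogeneous j _))
  refine ⟨p, fun N => ?_⟩
  rcases le_total N D with h | h
  · have he := Fin.castLE_injective h
    rw [← killCompl_toVars he, hpD, killCompl_sigma, killCompl_toVars]
  · have he := Fin.castLE_injective h
    rw [← sub_eq_zero]
    refine eq_zero_of_killCompl_eq_zero he ((isSymmetric_toVars N p).sub (hs N))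
      (sub_mem (toVars_mem_highFilt hph N) (hG N)) ?_
    rw [map_sub, killCompl_toVars, killCompl_sigma, killCompl_toVars, hpD, sub_self]

/-- The pre-`λ`-ring structure of `Λ`, given by plethysm. -/
def symPreLambda : PreLambdaRing SymFun where
  σ k g := (exists_plethysm k g).choose
  σ_zero g := toVars_ext fun N => by
    rw [(exists_plethysm 0 g).choose_spec N, (polyPreLambda (Fin N)).σ_zero, map_one]
  σ_one g := toVars_ext fun N => by
    rw [(exists_plethysm 1 g).choose_spec N, (polyPreLambda (Fin N)).σ_one]
  σ_add n f g := toVars_ext fun N => by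
    rw [(exists_plethysm n (f + g)).choose_spec N, map_add, (polyPreLambda (Fin N)).σ_add, map_sum]
    refine Finset.sum_congr rfl fun p _ => ?_
    rw [map_mul, (exists_plethysm p.1 f).choose_spec N, (exists_plethysm p.2 g).choose_spec N]

lemma toVars_sigma (N k : ℕ) (g : SymFun) :
    toVars N (symPreLambda.σ k g) = (polyPreLambda (Fin N)).σ k (toVars N g) :=
  (exists_plethysm k g).choose_spec N

lemma toVars_expSum (N K : ℕ) (g : SymFun) :
    toVars N (symPreLambda.expSum K g) = (polyPreLambda (Fin N)).expSum K (toVars N g) := by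
  simp only [PreLambdaRing.expSum, map_sum, toVars_sigma]

lemma isFiltration_wt : IsFiltration symPreLambda (lowFilt wt) where
  zero := lowFilt_zero
  anti := lowFilt_antitone
  mul _ _ _ _ := lowFilt_mul
  sigma m n a ha := mem_lowFilt_wt_iff.mpr fun N => by
    rw [toVars_sigma]
    exact (isFiltration_lowFilt _).sigma m n _ (mem_lowFilt_wt_iff.mp ha N)

lemma act_hSym {R : Type*} [CommRing R] (S : PreLambdaRing R) (k : ℕ) (a : R) :
    S.act (hSym k) a = S.σ k a := by
  cases k with
  | zero => rw [hSym, PreLambdaRing.act, map_one, S.σ_zero]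
  | succ k => rw [hSym, PreLambdaRing.act, aeval_X]

lemma isPlethysm_sigma (k : ℕ) (g : SymFun) : IsPlethysm (hSym k) g (symPreLambda.σ k g) :=
  fun N => by rw [act_hSym, toVars_sigma]

/-- The `λ`-ring axiom enters only here, and only with `f = h_k`. -/
lemma LambdaRing.sigma_act {R : Type*} [CommRing R] (S : LambdaRing R) (k : ℕ) (g : SymFun)
    (a : R) : S.σ k (S.act g a) = S.act (symPreLambda.σ k g) a := by
  rw [← act_hSym]
  exact S.act_act _ _ _ (isPlethysm_sigma k g) a

lemma LambdaRing.expSum_act {R : Type*} [CommRing R] (S : LambdaRing R) (K : ℕ) (g : SymFun)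
    (a : R) : S.expSum K (S.act g a) = S.act (symPreLambda.expSum K g) a := by
  simp only [PreLambdaRing.expSum, S.sigma_act]
  exact (map_sum (aeval (R := ℤ) fun n => S.σ (n + 1) a) _ _).symm

/-! ### The universal logarithm, degree by degree -/

/-- The approximations, up to degree `M`, of the plethystic logarithm of `1 + h_1`. -/
def logApprox : ℕ → SymFun
  | 0 => 0
  | M + 1 => logApprox M + weightedHomogeneousComponent wt (M + 1)
      (1 + X 0 - symPreLambda.expSum (M + 1) (logApprox M))

/-- The part of degree `n` of the plethystic logarithm of `1 + h_1`. -/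
def logSym : ℕ → SymFun
  | 0 => 0
  | n + 1 => weightedHomogeneousComponent wt (n + 1)
      (1 + X 0 - symPreLambda.expSum (n + 1) (logApprox n))

lemma logApprox_eq_sum (M : ℕ) : logApprox M = ∑ j ∈ Finset.range (M + 1), logSym j := by
  induction M with
  | zero => simp [logApprox, logSym]
  | succ M ih => rw [Finset.sum_range_succ, ← ih, logApprox, logSym]

lemma isWeightedHomogeneous_logSym (n : ℕ) : IsWeightedHomogeneous wt (logSym n) n := by
  cases n with
  | zero => exact isWeightedHomogeneous_zero _ _ _
  | succ n => exact weightedHomogeneousComponent_isWeightedHomogeneous _ _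

lemma logSym_mem_lowFilt (n : ℕ) : logSym n ∈ lowFilt wt n :=
  mem_lowFilt_of_isWeightedHomogeneous (isWeightedHomogeneous_logSym n)

lemma logApprox_mem_lowFilt (M : ℕ) : logApprox M ∈ lowFilt wt 1 := by
  rw [logApprox_eq_sum]
  refine sum_mem fun j _ => ?_
  cases j with
  | zero => exact zero_mem _
  | succ j => exact lowFilt_antitone (Nat.le_add_left 1 j) (logSym_mem_lowFilt _)

/-- By `expSum_add`, adding the lowest component of the error to the argument removes it from the
error and creates new terms only in weight `M + 2` or more. -/
lemma expSum_logApprox (M : ℕ) :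
    symPreLambda.expSum M (logApprox M) - (1 + X 0) ∈ lowFilt wt (M + 1) := by
  induction M with
  | zero =>
    have h : symPreLambda.expSum 0 (logApprox 0) - (1 + X 0) = -X 0 := by
      simp [PreLambdaRing.expSum, symPreLambda.σ_zero]
    rw [h, zero_add]
    exact neg_mem (mem_lowFilt_of_isWeightedHomogeneous (isWeightedHomogeneous_X ℤ wt 0))
  | succ M ih =>
    have h1 := isFiltration_wt.expSum_add (logApprox_mem_lowFilt M) (logSym_mem_lowFilt (M + 1)) M
    -- Lengthening the truncation from `M` to `M + 1` changes the exponential only in weight at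
    -- least `M + 1`.
    have h2 : 1 + X 0 - symPreLambda.expSum (M + 1) (logApprox M) ∈ lowFilt wt (M + 1) := by
      have := isFiltration_wt.expSum_sub_expSum (logApprox_mem_lowFilt M) (le_refl (M + 1))
        (Nat.le_succ M)
      have := add_mem this ih
      rw [← neg_mem_iff]
      convert this using 1
      ring
    have h3 := sub_weightedHomogeneousComponent_mem_lowFilt h2
    have := sub_mem h1 h3
    rw [logSym] at this
    rw [logApprox]
    convert this using 1
    ring

/-! ### Logarithmic derivative and Möbius inversion -/

section Newton

/-- Truncations of Cauchy products. -/
lemma sum_antidiagonal_sub_mul_mem {ι : Type*} {w : ι → ℕ} {a b : ℕ → MvPolynomial ι ℤ}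
    (ha : ∀ i, a i ∈ lowFilt w i) (hb : ∀ i, b i ∈ lowFilt w i) (M : ℕ) :
    ∑ k ∈ Finset.range (M + 1), ∑ p ∈ Finset.HasAntidiagonal.antidiagonal k, a p.1 * b p.2 -
      (∑ i ∈ Finset.range (M + 1), a i) * ∑ j ∈ Finset.range (M + 1), b j ∈
        lowFilt w (M + 1) := by
  set s := Finset.range (M + 1) ×ˢ Finset.range (M + 1) with hs
  have h1 : ∑ k ∈ Finset.range (M + 1), ∑ p ∈ Finset.HasAntidiagonal.antidiagonal k,
      a p.1 * b p.2 = ∑ p ∈ s with p.1 + p.2 ≤ M, a p.1 * b p.2 := by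
    rw [← Finset.sum_fiberwise_of_maps_to (t := Finset.range (M + 1)) 
      (g := fun p : ℕ × ℕ => p.1 + p.2)]
    · refine Finset.sum_congr rfl fun k hk => Finset.sum_congr ?_ fun _ _ => rfl
      have hk := Finset.mem_range.mp hk
      ext p
      simp only [hs, Finset.HasAntidiagonal.mem_antidiagonal, Finset.mem_filter,
        Finset.mem_product, Finset.mem_range]
      omega
    · intro p hp
      simp only [Finset.mem_filter] at hp
      exact Finset.mem_range.mpr (by omega)
  -- The product of the truncations also contains pairs with `i + j > M`; these have weight at least
  -- `M + 1`.
  rw [h1, Finset.sum_mul_sum, ← Finset.sum_product', ← hs,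
    ← Finset.sum_filter_add_sum_filter_not s (fun p => p.1 + p.2 ≤ M), sub_add_cancel_left]
  refine neg_mem (sum_mem fun p hp => ?_)
  have := (Finset.mem_filter.mp hp).2
  exact lowFilt_antitone (by omega) (lowFilt_mul (ha p.1) (hb p.2))

variable {N : ℕ}

lemma isWeightedHomogeneous_sum_X :
    IsWeightedHomogeneous (1 : Fin N → ℕ) (∑ i : Fin N, X i : MvPolynomial (Fin N) ℤ) 1 :=
  IsWeightedHomogeneous.sum _ _ _ fun i _ => isWeightedHomogeneous_X ℤ _ i

lemma toVars_X_zero : toVars N (X 0) = (∑ i : Fin N, X i : MvPolynomial (Fin N) ℤ) := by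
  rw [toVars, aeval_X, zero_add, hsymm_one]

lemma euler_sum_X : euler (∑ i : Fin N, X i : MvPolynomial (Fin N) ℤ) = (∑ i : Fin N, X i : MvPolynomial (Fin N) ℤ) := by
  rw [euler_of_isWeightedHomogeneous isWeightedHomogeneous_sum_X, one_smul]

lemma expand_sum_X (d : ℕ) : expand d (∑ i : Fin N, X i : MvPolynomial (Fin N) ℤ) = psum (Fin N) ℤ d := by
  simp [psum]

/-- For `y = ∑ x_i` the formula `euler_sigma` is Newton's identity, since `D h_n = n h_n` and `ψ_i(D
y) = p_i`; this is the recursion defining `pSym`. -/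
lemma toVars_pSym (n : ℕ) : toVars N (pSym (n + 1)) = psum (Fin N) ℤ (n + 1) := by
  induction n using Nat.strong_induction_on with
  | _ n ih =>
    have h := euler_sigma (∑ i : Fin N, X i : MvPolynomial (Fin N) ℤ) (n + 1)
    rw [sigma_sum_X, euler_of_isWeightedHomogeneous (isWeightedHomogeneous_hsymm N (n + 1)),
      euler_sum_X, Finset.Nat.sum_antidiagonal_succ, if_pos rfl, zero_mul, zero_add] at h
    simp only [Nat.succ_ne_zero, if_false, expand_sum_X, sigma_sum_X] at h
    rw [Finset.Nat.sum_antidiagonal_eq_sum_range_succ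
      (f := fun i j => psum (Fin N) ℤ (i + 1) * hsymm (Fin N) ℤ j), Finset.sum_range_succ,
      Nat.sub_self, hsymm_zero, mul_one] at h
    rw [pSym, map_sub, map_mul, map_natCast, map_sum, toVars_hSym, ← nsmul_eq_mul, h,
      sub_eq_iff_eq_add, add_comm, add_right_inj,
      ← Fin.sum_univ_eq_sum_range (fun i => psum (Fin N) ℤ (i + 1) * hsymm (Fin N) ℤ (n - i))]
    refine Finset.sum_congr rfl fun r _ => ?_
    rw [map_mul, toVars_hSym, ih r r.2, mul_comm]

/-- The expansion `log(1 + p_1) = ∑ ψ_i(ℓ_j) / i`, differentiated, in degree `n = i j`. -/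
lemma sum_expand_logSym (n : ℕ) (hn : n ≠ 0) :
    ∑ d ∈ n.divisorsAntidiagonal, expand d.1 (d.2 • toVars N (logSym d.2)) =
      (-1) ^ (n - 1) * (∑ i : Fin N, X i : MvPolynomial (Fin N) ℤ) ^ n := by
  set p : MvPolynomial (Fin N) ℤ := ∑ i : Fin N, X i with hp
  set w : Fin N → ℕ := 1 with hw
  set y := toVars N (logApprox n) with hy
  have hy1 : y ∈ lowFilt w 1 := mem_lowFilt_wt_iff.mp (logApprox_mem_lowFilt n) N
  set a : ℕ → MvPolynomial (Fin N) ℤ := fun i => if i = 0 then 0 else expand i (euler y) with ha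
  have ha_mem : ∀ i, a i ∈ lowFilt w i := by
    intro i
    simp only [ha]
    split_ifs with h
    · exact zero_mem _
    · simpa using expand_mem_lowFilt (euler_mem_lowFilt hy1) i
  set T := ∑ i ∈ Finset.range (n + 1), a i with hT
  set E := (polyPreLambda (Fin N)).expSum n y with hE
  have h1 : E - (1 + p) ∈ lowFilt w (n + 1) := by
    have := mem_lowFilt_wt_iff.mp (expSum_logApprox n) N
    rwa [map_sub, toVars_expSum, map_add, map_one, toVars_X_zero] at this
  have h2 : euler E - p ∈ lowFilt w (n + 1) := by
    have := euler_mem_lowFilt h1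
    rwa [map_sub, map_add, Derivation.map_one_eq_zero, zero_add, euler_sum_X] at this
  have h3 : euler E - T * E ∈ lowFilt w (n + 1) := by
    have := sum_antidiagonal_sub_mul_mem ha_mem
      (fun j => (isFiltration_lowFilt w).sigma_mem hy1 (mul_one j).ge) n
    simp only [ha, ← euler_sigma] at this
    rw [← map_sum] at this
    exact this
  -- Modulo weight `n + 1`, `D E = T E`, `E = 1 + p` and `D E = p`, where `T` truncates `∑ ψ_i(D
  -- y)`.
  have h4 : p - T * (1 + p) ∈ lowFilt w (n + 1) := by
    have := add_mem (sub_mem h3 h2) ((isFiltration_lowFilt w).mul_mem_left T h1)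
    convert this using 1
    ring
  have hpl : ∀ k, IsWeightedHomogeneous w (p ^ k) k := fun k => by
    simpa using isWeightedHomogeneous_sum_X.pow k
  have hneg : ∀ k, (-p) ^ k = (-1) ^ k * p ^ k := fun k => neg_pow p k
  -- Division by `1 + p` is multiplication by the truncated geometric series in `-p`.
  have h5 : T - p * ∑ k ∈ Finset.range (n + 1), (-p) ^ k ∈ lowFilt w (n + 1) := by
    have hg := mul_neg_geom_sum (-p) (n + 1)
    have hm : (-p) ^ (n + 1) ∈ lowFilt w (n + 1) := by
      rw [hneg]
      exact (isFiltration_lowFilt w).mul_mem_left _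
        (mem_lowFilt_of_isWeightedHomogeneous (hpl _))
    have := sub_mem ((isFiltration_lowFilt w).mul_mem_left T hm)
      ((isFiltration_lowFilt w).mul_mem_left (∑ k ∈ Finset.range (n + 1), (-p) ^ k) h4)
    convert this using 1
    linear_combination -T * hg
  have h6 := weightedHomogeneousComponent_of_mem_lowFilt h5 (Nat.lt_succ_self n)
  rw [map_sub, sub_eq_zero] at h6
  have h7 : weightedHomogeneousComponent w n (p * ∑ k ∈ Finset.range (n + 1), (-p) ^ k) =
      (-1) ^ (n - 1) * p ^ n := by
    have hk : ∀ k, IsWeightedHomogeneous w (p * (-p) ^ k) (k + 1) := fun k => by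
      rw [hneg, mul_left_comm, ← pow_succ']
      have hc : ((-1) ^ k : MvPolynomial (Fin N) ℤ) = C ((-1) ^ k) := by simp
      rw [hc]
      exact (hpl (k + 1)).C_mul _
    rw [Finset.mul_sum, map_sum, Finset.sum_eq_single (n - 1)]
    · have e : n = n - 1 + 1 := by omega
      rw [weightedHomogeneousComponent_of_mem (hk _), if_pos e, hneg, mul_left_comm, ← pow_succ',
        ← e]
    · intro k _ hkn
      rw [weightedHomogeneousComponent_of_mem (hk _), if_neg (by omega)]
    · intro h
      exact absurd (Finset.mem_range.mpr (by omega)) h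
  have hl : ∀ j, IsWeightedHomogeneous w (toVars N (logSym j)) j := fun j => by
    have := weightedHomogeneousComponent_isWeightedHomogeneous (w := w) j (toVars N (logSym j))
    rwa [← toVars_weightedHomogeneousComponent,
      weightedHomogeneousComponent_eq_self (isWeightedHomogeneous_logSym j)] at this
  -- Splitting `y` into its components `ℓ_j`, on which `D` is multiplication by `j`, makes `T` a
  -- double sum whose `(i, j)` term has degree `i j`; the degree `n` part picks out the divisor
  -- pairs of `n`.
  have h8 : T = ∑ q ∈ Finset.range (n + 1) ×ˢ Finset.range (n + 1),
      if q.1 = 0 then 0 else expand q.1 (q.2 • toVars N (logSym q.2)) := by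
    rw [hT, Finset.sum_product]
    refine Finset.sum_congr rfl fun i _ => ?_
    simp only [ha]
    split_ifs
    · exact Finset.sum_const_zero.symm
    · rw [hy, logApprox_eq_sum, map_sum, map_sum, map_sum]
      exact Finset.sum_congr rfl fun j _ => by rw [euler_of_isWeightedHomogeneous (hl j)]
  rw [← h7, ← h6, h8, map_sum]
  have h9 : n.divisorsAntidiagonal =
      (Finset.range (n + 1) ×ˢ Finset.range (n + 1)).filter fun q => q.1 * q.2 = n := by
    ext q
    simp only [Nat.mem_divisorsAntidiagonal, Finset.mem_filter, Finset.mem_product,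
      Finset.mem_range, Nat.lt_succ_iff]
    refine ⟨fun h => ⟨⟨?_, ?_⟩, h.1⟩, fun h => ⟨h.2, hn⟩⟩
    · exact Nat.le_of_dvd (Nat.pos_of_ne_zero hn) ⟨_, h.1.symm⟩
    · exact Nat.le_of_dvd (Nat.pos_of_ne_zero hn) ⟨_, (mul_comm _ _).trans h.1 |>.symm⟩
  rw [h9, Finset.sum_filter]
  refine Finset.sum_congr rfl fun q _ => ?_
  have hq : IsWeightedHomogeneous w (expand q.1 (q.2 • toVars N (logSym q.2))) (q.1 * q.2) := by
    rw [map_nsmul, nsmul_eq_mul, ← map_natCast (C : ℤ →+* MvPolynomial (Fin N) ℤ)]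
    exact (isWeightedHomogeneous_expand (hl q.2) q.1).C_mul _
  by_cases h0 : q.1 = 0
  · rw [if_pos h0, map_zero, if_neg]
    rintro rfl
    exact hn (by rw [h0, zero_mul])
  · rw [if_neg h0, weightedHomogeneousComponent_of_mem hq]
    exact if_congr eq_comm rfl rfl

/-- The substitutions `x_i ↦ x_i ^ n`, as an arithmetic function. -/
def adamsFun (N : ℕ) : ArithmeticFunction (Module.End ℤ (MvPolynomial (Fin N) ℤ)) :=
  ⟨fun n => if n = 0 then 0 else (expand n).toLinearMap, if_pos rfl⟩

lemma adamsFun_apply {n : ℕ} (hn : n ≠ 0) (f : MvPolynomial (Fin N) ℤ) :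
    adamsFun N n f = expand n f := by
  change (if n = 0 then 0 else (expand n).toLinearMap : Module.End ℤ _) f = _
  rw [if_neg hn]
  rfl

/-- The inverse of `adamsFun` for Dirichlet convolution. -/
def moebiusAdamsFun (N : ℕ) : ArithmeticFunction (Module.End ℤ (MvPolynomial (Fin N) ℤ)) :=
  ⟨fun n => ArithmeticFunction.moebius n • adamsFun N n, by simp⟩

lemma moebiusAdamsFun_apply (n : ℕ) :
    moebiusAdamsFun N n = ArithmeticFunction.moebius n • adamsFun N n := rfl

/-- Because `ψ_d ψ_e = ψ_{de}`, the function `n ↦ ψ_n` is completely multiplicative, so its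
pointwise product with `μ` is a Dirichlet inverse, just as `μ` is inverse to `ζ`. -/
lemma moebiusAdamsFun_mul_adamsFun : moebiusAdamsFun N * adamsFun N = 1 := by
  ext1 n
  rcases eq_or_ne n 0 with rfl | hn
  · simp
  have h1 : ∀ d ∈ n.divisorsAntidiagonal, moebiusAdamsFun N d.1 * adamsFun N d.2 =
      (ArithmeticFunction.moebius d.1 * ArithmeticFunction.zeta d.2 : ℤ) • adamsFun N n := by
    intro d hd
    obtain ⟨rfl, -⟩ := Nat.mem_divisorsAntidiagonal.mp hd
    have hd1 : d.1 ≠ 0 := left_ne_zero_of_mul hn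
    have hd2 : d.2 ≠ 0 := right_ne_zero_of_mul hn
    rw [ArithmeticFunction.zeta_apply_ne hd2, Nat.cast_one, mul_one, moebiusAdamsFun_apply,
      smul_mul_assoc]
    congr 1
    refine LinearMap.ext fun f => ?_
    rw [Module.End.mul_apply, adamsFun_apply hd2, adamsFun_apply hd1, adamsFun_apply hn,
      expand_mul]
  rw [ArithmeticFunction.mul_apply, Finset.sum_congr rfl h1, ← Finset.sum_smul]
  have h2 := congrArg (fun f : ArithmeticFunction ℤ => f n)
    ArithmeticFunction.moebius_mul_coe_zeta
  simp only [ArithmeticFunction.mul_apply, ArithmeticFunction.natCoe_apply] at h2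
  rw [h2, ArithmeticFunction.one_apply, ArithmeticFunction.one_apply]
  split_ifs with h
  · rw [one_smul, h]
    refine LinearMap.ext fun f => ?_
    rw [adamsFun_apply one_ne_zero, expand_one_apply, Module.End.one_apply]
  · rw [zero_smul]

/-- `sum_expand_logSym` is a Dirichlet convolution of the Adams operations with `n ↦ n ℓ_n`.
Inverting it and using `ψ_d(p_1^m) = p_d^m` gives the formula. -/
lemma nsmul_toVars_logSym (n : ℕ) (hn : n ≠ 0) :
    n • toVars N (logSym n) = ∑ d ∈ n.divisorsAntidiagonal,
      ((ArithmeticFunction.moebius d.1 : ℤ) * (-1) ^ (d.2 - 1)) •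
        psum (Fin N) ℤ d.1 ^ d.2 := by
  let f : ArithmeticFunction (MvPolynomial (Fin N) ℤ) :=
    ⟨fun n => n • toVars N (logSym n), by simp⟩
  let q : ArithmeticFunction (MvPolynomial (Fin N) ℤ) :=
    ⟨fun n => if n = 0 then 0 else (-1) ^ (n - 1) * (∑ i : Fin N, X i) ^ n, if_pos rfl⟩
  have h1 : adamsFun N • f = q := by
    ext1 n
    rcases eq_or_ne n 0 with rfl | hn
    · simp
    change _ = if n = 0 then 0 else _
    rw [if_neg hn, ← sum_expand_logSym n hn, ArithmeticFunction.smul_apply]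
    refine Finset.sum_congr rfl fun d hd => ?_
    obtain ⟨rfl, -⟩ := Nat.mem_divisorsAntidiagonal.mp hd
    exact adamsFun_apply (left_ne_zero_of_mul hn) _
  have h2 : f = moebiusAdamsFun N • q := by
    rw [← h1, ← ArithmeticFunction.mul_smul', moebiusAdamsFun_mul_adamsFun,
      ArithmeticFunction.one_smul']
  have h3 : f n = (moebiusAdamsFun N • q) n := by rw [← h2]
  refine h3.trans ?_
  rw [ArithmeticFunction.smul_apply]
  refine Finset.sum_congr rfl fun d hd => ?_
  obtain ⟨rfl, -⟩ := Nat.mem_divisorsAntidiagonal.mp hd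
  rw [moebiusAdamsFun_apply, Module.End.smul_def, LinearMap.smul_apply,
    adamsFun_apply (left_ne_zero_of_mul hn), mul_smul]
  congr 1
  change expand d.1 (if d.2 = 0 then 0 else _) = _
  rw [if_neg (right_ne_zero_of_mul hn), map_mul, map_pow, map_pow, expand_sum_X, map_neg, map_one,
    zsmul_eq_mul]
  push_cast
  rfl

end Newton

/-- `n Log_n = ∑_{d m = n} μ(d) (-1)^(m-1) p_d^m` in `Λ`. -/
lemma nsmul_logSym (n : ℕ) (hn : n ≠ 0) :
    n • logSym n = ∑ d ∈ n.divisorsAntidiagonal,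
      ((ArithmeticFunction.moebius d.1 : ℤ) * (-1) ^ (d.2 - 1)) • pSym d.1 ^ d.2 := by
  refine toVars_ext fun N => ?_
  rw [map_nsmul, nsmul_toVars_logSym n hn, map_sum]
  refine Finset.sum_congr rfl fun d hd => ?_
  obtain ⟨rfl, -⟩ := Nat.mem_divisorsAntidiagonal.mp hd
  obtain ⟨e, he⟩ := Nat.exists_eq_succ_of_ne_zero (left_ne_zero_of_mul hn)
  rw [map_zsmul, map_pow, he, Nat.succ_eq_add_one, toVars_pSym]

lemma map_logSym (n : ℕ) (hn : 1 ≤ n) :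
    MvPolynomial.map (Int.castRingHom ℚ) (logSym n) = logPart n := by
  have hn0 : n ≠ 0 := Nat.one_le_iff_ne_zero.mp hn
  have hnq : (n : ℚ) ≠ 0 := Nat.cast_ne_zero.mpr hn0
  have h := congrArg (MvPolynomial.map (Int.castRingHom ℚ)) (nsmul_logSym n hn0)
  refine mul_left_cancel₀ (a := (C (n : ℚ) : MvPolynomial ℕ ℚ)) ?_ ?_
  · simpa using hn0
  rw [map_nsmul, nsmul_eq_mul, map_sum] at h
  rw [map_natCast, h, logPart, Finset.mul_sum]
  refine Finset.sum_congr rfl fun d hd => ?_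
  obtain ⟨hd1, -⟩ := Nat.mem_divisorsAntidiagonal.mp hd
  have h1 : (d.1 : ℚ) ≠ 0 := Nat.cast_ne_zero.mpr (left_ne_zero_of_mul (hd1.trans_ne hn0))
  have h2 : (d.2 : ℚ) ≠ 0 := Nat.cast_ne_zero.mpr (right_ne_zero_of_mul (hd1.trans_ne hn0))
  have hc : (n : ℚ) * ((ArithmeticFunction.moebius d.1 : ℚ) / (d.1 : ℚ) *
      ((-1) ^ (d.2 - 1) / (d.2 : ℚ))) = (ArithmeticFunction.moebius d.1 : ℚ) *
      (-1) ^ (d.2 - 1) := by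
    rw [← hd1]
    push_cast
    field_simp
  rw [← mul_assoc, ← map_natCast (C : ℚ →+* MvPolynomial ℕ ℚ), ← C_mul, hc, zsmul_eq_mul, map_mul,
    map_pow, map_intCast]
  simp

/-! ### Characters of induced representations -/

section Trace

/-- The trace on coinvariants is the average of traces. -/
lemma trace_coinvariants_map {G V : Type*} [Group G] [Fintype G] [AddCommGroup V] [Module ℂ V]
    [Module.Finite ℂ V] (ρ : Representation ℂ G V) (f : ρ.IntertwiningMap ρ) :
    LinearMap.trace ℂ _ (Representation.Coinvariants.map ρ ρ f) =
      (Fintype.card G : ℂ)⁻¹ * ∑ g, LinearMap.trace ℂ V (ρ g ∘ₗ f.toLinearMap) := by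
  have hG : (Fintype.card G : ℂ) ≠ 0 := Nat.cast_ne_zero.mpr Fintype.card_ne_zero
  let avg : V →ₗ[ℂ] V := (Fintype.card G : ℂ)⁻¹ • ∑ g, ρ g
  have havg : ∀ h, avg ∘ₗ ρ h = avg := fun h => by
    ext x
    simp only [avg, LinearMap.comp_apply, LinearMap.smul_apply, LinearMap.sum_apply]
    congr 1
    refine Fintype.sum_equiv (Equiv.mulRight h) _ _ fun g => ?_
    rw [Equiv.coe_mulRight, map_mul, Module.End.mul_apply]
  -- Averaging over `G` factors through the coinvariants and gives a section of the quotient map.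
  -- Cyclicity of the trace then moves the computation from the quotient back to `V`.
  let ι : ρ.Coinvariants →ₗ[ℂ] V := Representation.Coinvariants.lift ρ avg havg
  have hι : Representation.Coinvariants.mk ρ ∘ₗ ι = LinearMap.id := by
    refine Representation.Coinvariants.hom_ext (LinearMap.ext fun x => ?_)
    change Representation.Coinvariants.mk ρ (avg x) = Representation.Coinvariants.mk ρ x
    simp only [avg, LinearMap.smul_apply, LinearMap.sum_apply, map_smul, map_sum,
      Representation.Coinvariants.mk_self_apply, Finset.sum_const, Finset.card_univ]
    rw [← Nat.cast_smul_eq_nsmul ℂ, smul_smul, inv_mul_cancel₀ hG, one_smul]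
  have h1 : ι ∘ₗ Representation.Coinvariants.map ρ ρ f ∘ₗ Representation.Coinvariants.mk ρ =
      (Fintype.card G : ℂ)⁻¹ • ∑ g, ρ g ∘ₗ f.toLinearMap := by
    rw [Representation.Coinvariants.map_comp_mk]
    ext x
    simp only [LinearMap.smul_apply, LinearMap.sum_apply, LinearMap.comp_apply]
    change avg (f.toLinearMap x) = _
    simp only [avg, LinearMap.smul_apply, LinearMap.sum_apply]
  have h2 := LinearMap.trace_comp_comm' ι
    (Representation.Coinvariants.map ρ ρ f ∘ₗ Representation.Coinvariants.mk ρ)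
  rw [LinearMap.comp_assoc, hι, LinearMap.comp_id, h1, map_smul, map_sum, smul_eq_mul] at h2
  exact h2

lemma trace_mapDomainLinearMap {G : Type*} [Fintype G] [DecidableEq G] (π : G → G) :
    LinearMap.trace ℂ _ (MonoidAlgebra.mapDomainLinearMap ℂ ℂ π) =
      ∑ g, if π g = g then (1 : ℂ) else 0 := by
  rw [LinearMap.trace_eq_matrix_trace ℂ (MonoidAlgebra.basis G ℂ), Matrix.trace]
  refine Finset.sum_congr rfl fun g _ => ?_
  rw [Matrix.diag_apply, LinearMap.toMatrix_apply, MonoidAlgebra.basis_apply,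
    MonoidAlgebra.mapDomainLinearMap_single]
  change (Finsupp.single (π g) (1 : ℂ)) g = _
  rw [Finsupp.single_apply]

lemma trace_charRep {G : Type*} [Monoid G] (χ : G →* ℂ) (g : G) :
    LinearMap.trace ℂ ℂ (charRep χ g) = χ g := by
  have : charRep χ g = χ g • LinearMap.id := by
    ext
    simp [charRep]
  rw [this, map_smul, LinearMap.trace_id]
  simp

/-- The character of a representation induced from a multiplicative character. -/
lemma trace_ind_charRep {G H : Type*} [Group G] [Fintype G] [Group H] [Fintype H] [DecidableEq H]
    (φ : G →* H) (χ : G →* ℂ) (h : H) :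
    LinearMap.trace ℂ _ (Representation.ind φ (charRep χ) h) =
      (Fintype.card G : ℂ)⁻¹ * ∑ g, ∑ x, if h = x⁻¹ * φ g * x then χ g else 0 := by
  have : Module.Finite ℂ (MonoidAlgebra ℂ H) := Module.Finite.of_basis (MonoidAlgebra.basis H ℂ)
  have : Module.Free ℂ (MonoidAlgebra ℂ H) := Module.Free.of_basis (MonoidAlgebra.basis H ℂ)
  refine (trace_coinvariants_map _ _).trans ?_
  congr 1
  refine Finset.sum_congr rfl fun g _ => ?_
  -- The induced module is the space of coinvariants of `ℂ[H] ⊗ χ`, with `h` acting by right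
  -- multiplication by `h⁻¹`. Combined with `g` this permutes the basis `H` by `x ↦ φ(g) x h⁻¹`, and
  -- the trace counts fixed points.
  have h1 : Representation.tprod ((Representation.leftRegular ℂ H).comp φ) (charRep χ) g ∘ₗ
      (MonoidAlgebra.mapDomainLinearMap ℂ ℂ fun x => x * h⁻¹).rTensor ℂ =
      TensorProduct.map (MonoidAlgebra.mapDomainLinearMap ℂ ℂ fun x => φ g * (x * h⁻¹))
        (charRep χ g) := by
    rw [Representation.tprod_apply, LinearMap.rTensor, ← TensorProduct.map_comp, LinearMap.comp_id]
    congr 1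
    ext x
    simp
  refine (congrArg (LinearMap.trace ℂ _) h1).trans ?_
  rw [LinearMap.trace_tensorProduct', trace_mapDomainLinearMap, trace_charRep, Finset.sum_mul]
  refine Finset.sum_congr rfl fun x _ => ?_
  have : φ g * (x * h⁻¹) = x ↔ h = x⁻¹ * φ g * x := by
    rw [← mul_assoc, mul_inv_eq_iff_eq_mul, mul_assoc, eq_inv_mul_iff_mul_eq, eq_comm]
  simp only [this]
  split_ifs <;> simp

end Trace

/-! ### Cycle types in the cyclic group and sums of roots of unity -/

section CycleType

open Equiv.Perm

variable {α : Type*} [Fintype α] [DecidableEq α]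

/-- The product of the power sums over the cycles of a permutation. -/
def cyclePSum (s : Equiv.Perm α) : MvPolynomial ℕ ℂ :=
  (s.partition.parts.map fun k => MvPolynomial.map (Int.castRingHom ℂ) (pSym k)).prod

lemma cyclePSum_conj (s x : Equiv.Perm α) : cyclePSum (x⁻¹ * s * x) = cyclePSum s := by
  have h : IsConj s (x⁻¹ * s * x) := isConj_iff.mpr ⟨x⁻¹, by rw [inv_inv]⟩
  have hp : ∀ (p q : (Fintype.card α).Partition), p = q → p.parts = q.parts := by
    rintro p _ rfl; rfl
  rw [cyclePSum, cyclePSum, hp _ _ (partition_eq_of_isConj.mp h)]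

/-- Compared with `cycleType`, each fixed point adds one to both the sum and the number of parts,
which leaves the sign unchanged. -/
lemma sign_eq_parts (s : Equiv.Perm α) :
    sign s = (-1) ^ (s.partition.parts.sum + s.partition.parts.card) := by
  rw [sign_of_cycleType, parts_partition, Multiset.sum_add, Multiset.card_add,
    Multiset.sum_replicate, Multiset.card_replicate, smul_eq_mul, mul_one]
  have : ∀ a b c : ℕ, a + c + (b + c) = a + b + 2 * c := fun a b c => by ring
  rw [this, pow_add _ _ (2 * _), pow_mul, neg_one_sq, one_pow, mul_one]

lemma exists_pow_apply_eq_of_mem_cycleType {s : Equiv.Perm α} {k : ℕ} (hk : k ∈ s.cycleType) :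
    ∃ x, (s ^ k) x = x := by
  obtain ⟨c, τ, rfl, hd, hc, rfl⟩ := mem_cycleType_iff.mp hk
  obtain ⟨x, hx⟩ := hc.nonempty_support
  refine ⟨x, ?_⟩
  have hτ : τ x = x := hd.mem_imp (mem_support.mp hx |> fun h => mem_support.mpr h) |> notMem_support.mp
  rw [hd.commute.mul_pow, mul_apply, pow_apply_eq_self_of_apply_eq_self hτ, ← hc.orderOf,
    pow_orderOf_eq_one, one_apply]

lemma sign_conj (s x : Equiv.Perm α) : sign (x⁻¹ * s * x) = sign s := by
  rw [Equiv.Perm.sign_mul, Equiv.Perm.sign_mul, Equiv.Perm.sign_inv, mul_right_comm, Int.units_mul_self, one_mul]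

lemma cyclicIncl_pow_apply (n : ℕ) (c : Multiplicative (ZMod n)) (k : ℕ) (x : ZMod n) :
    (cyclicIncl n c ^ k) x = x + k • c.toAdd := by
  rw [← map_pow]
  rfl

variable (n : ℕ) [NeZero n]

lemma sum_parts_partition (s : Equiv.Perm (ZMod n)) : s.partition.parts.sum = n :=
  s.partition.parts_sum.trans (ZMod.card n)

/-- A power of a translation with one fixed point is the identity, so every cycle has length equal
to the order of `c`. -/
lemma parts_cyclicIncl (c : Multiplicative (ZMod n)) :
    (cyclicIncl n c).partition.parts =
      Multiset.replicate (n / addOrderOf c.toAdd) (addOrderOf c.toAdd) := by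
  set d := addOrderOf c.toAdd with hd
  set s := cyclicIncl n c with hs
  have hdpos : 0 < d := addOrderOf_pos _
  have h1 : ∀ k ∈ s.partition.parts, k = d := by
    intro k hk
    rw [parts_partition, Multiset.mem_add] at hk
    rcases hk with hk | hk
    · refine Nat.dvd_antisymm ?_ ?_
      · refine (dvd_of_mem_cycleType hk).trans (orderOf_dvd_of_pow_eq_one ?_)
        ext x
        rw [hs, cyclicIncl_pow_apply, hd, addOrderOf_nsmul_eq_zero, add_zero, one_apply]
      · obtain ⟨x, hx⟩ := exists_pow_apply_eq_of_mem_cycleType hk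
        rw [hs, cyclicIncl_pow_apply, add_eq_left] at hx
        exact addOrderOf_dvd_of_nsmul_eq_zero hx
    · obtain ⟨h0, rfl⟩ := Multiset.mem_replicate.mp hk
      obtain ⟨x, hx⟩ : ∃ x, x ∉ s.support := by
        by_contra hcon
        push Not at hcon
        rw [Finset.eq_univ_iff_forall.mpr hcon, Finset.card_univ, Nat.sub_self] at h0
        exact h0 rfl
      have hx := notMem_support.mp hx
      have := cyclicIncl_pow_apply n c 1 x
      rw [pow_one, one_smul] at this
      rw [hs, this, add_eq_left] at hx
      rw [hd, hx, addOrderOf_zero]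
  have h2 := Multiset.eq_replicate_card.mpr h1
  have h3 := sum_parts_partition n s
  rw [h2, Multiset.sum_replicate, smul_eq_mul] at h3
  rw [h2]
  congr 1
  exact (Nat.div_eq_of_eq_mul_left hdpos h3.symm).symm

/-- The sums of the `d`-th primitive roots of unity, as character sums. -/
lemma sum_stdAddChar_addOrderOf (d : ℕ) (hd : d ∣ n) :
    ∑ c : ZMod n with addOrderOf c = d, ZMod.stdAddChar c = (ArithmeticFunction.moebius d : ℂ) := by
  -- Summing over all orders dividing `e` gives the sum of the character over the `e`-torsion, which
  -- is `0` unless `e = 1`. Möbius inversion on the divisors of `n` finishes.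
  have key : ∀ e > 0, e ∈ {e | e ∣ n} → ∑ i ∈ e.divisors,
      ∑ c : ZMod n with addOrderOf c = i, (ZMod.stdAddChar c : ℂ) = if e = 1 then (1 : ℂ) else 0 := by
    intro e he (hen : e ∣ n)
    have h1 : ∑ i ∈ e.divisors, ∑ c : ZMod n with addOrderOf c = i, (ZMod.stdAddChar c : ℂ) =
        ∑ c : ZMod n with e • c = 0, ZMod.stdAddChar c := by
      refine Eq.trans ?_ (Finset.sum_fiberwise_of_maps_to
        (s := Finset.univ.filter fun c : ZMod n => e • c = 0) (t := e.divisors)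
        (g := fun c : ZMod n => addOrderOf c) ?_ _)
      · refine Finset.sum_congr rfl fun i hi => Finset.sum_congr ?_ fun _ _ => rfl
        ext c
        simp only [Finset.mem_filter, Finset.mem_univ, true_and]
        refine ⟨fun h => ⟨?_, h⟩, fun h => h.2⟩
        rw [← addOrderOf_dvd_iff_nsmul_eq_zero, h]
        exact Nat.dvd_of_mem_divisors hi
      · intro c hc
        rw [Nat.mem_divisors, addOrderOf_dvd_iff_nsmul_eq_zero]
        exact ⟨(Finset.mem_filter.mp hc).2, he.ne'⟩
    rw [h1]
    split_ifs with h
    · subst h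
      have : (Finset.univ.filter fun c : ZMod n => 1 • c = 0) = {0} := by
        ext c; simp
      rw [this, Finset.sum_singleton, AddChar.map_zero_eq_one]
    -- The class of `m = n / e` is a nonzero `e`-torsion element. Translation by it multiplies the
    -- sum by a value different from `1`, as the standard character is injective.
    · obtain ⟨m, hm⟩ := hen
      have hm0 : m ≠ 0 := by
        rintro rfl
        exact NeZero.ne n (by simpa using hm)
      have hec : e • (m : ZMod n) = 0 := by
        rw [nsmul_eq_mul, ← Nat.cast_mul, ← hm, ZMod.natCast_self]
      have hm1 : (m : ZMod n) ≠ 0 := by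
        rw [Ne, ZMod.natCast_eq_zero_iff]
        intro hdvd
        have := Nat.le_of_dvd (Nat.pos_of_ne_zero hm0) hdvd
        have h2 : 2 ≤ e := by omega
        nlinarith [Nat.pos_of_ne_zero hm0]
      have hχ : (ZMod.stdAddChar (m : ZMod n) : ℂ) ≠ 1 := by
        intro hcon
        rw [← AddChar.map_zero_eq_one (ZMod.stdAddChar (N := n))] at hcon
        exact hm1 (ZMod.injective_stdAddChar hcon)
      have hshift : ∑ c : ZMod n with e • c = 0, ZMod.stdAddChar c =
          (ZMod.stdAddChar (m : ZMod n) : ℂ) * ∑ c : ZMod n with e • c = 0, ZMod.stdAddChar c := by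
        rw [Finset.mul_sum]
        symm
        refine Finset.sum_equiv (Equiv.addLeft (m : ZMod n)) ?_ ?_
        · intro c
          simp only [Finset.mem_filter, Finset.mem_univ, true_and, Equiv.coe_addLeft, smul_add, hec,
            zero_add]
        · intro c _
          rw [Equiv.coe_addLeft, AddChar.map_add_eq_mul]
      have h0 : (1 - (ZMod.stdAddChar (m : ZMod n) : ℂ)) *
          ∑ c : ZMod n with e • c = 0, ZMod.stdAddChar c = 0 := by
        rw [sub_mul, one_mul, ← hshift, sub_self]
      exact (mul_eq_zero.mp h0).resolve_left (sub_ne_zero.mpr hχ.symm)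
  have hdpos : 0 < d := Nat.pos_of_dvd_of_pos hd (NeZero.pos n)
  rw [← (ArithmeticFunction.sum_eq_iff_sum_mul_moebius_eq_on {e | e ∣ n}
    (fun _ _ h1 h2 => h1.trans h2)).mp key d hdpos hd,
    Nat.sum_divisorsAntidiagonal (fun i j => (ArithmeticFunction.moebius i : ℂ) *
      if j = 1 then 1 else 0), Finset.sum_eq_single d]
  · rw [Nat.div_self hdpos, if_pos rfl, mul_one]
  · intro i hi hid
    rw [if_neg, mul_zero]
    intro h
    obtain ⟨j, rfl⟩ := Nat.dvd_of_mem_divisors hi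
    rw [Nat.mul_div_cancel_left j (Nat.pos_of_mul_pos_right hdpos)] at h
    exact hid (by rw [h, mul_one])
  · intro h
    exact absurd (Nat.mem_divisors.mpr ⟨dvd_rfl, hdpos.ne'⟩) h

end CycleType

/-! ### The Frobenius characteristic of the induced module -/

section Characteristic

variable (n : ℕ) [NeZero n]

lemma trace_indChiSign (s : Equiv.Perm (ZMod n)) :
    LinearMap.trace ℂ _ (indChiSign n s) =
      (n : ℂ)⁻¹ * (∑ c : Multiplicative (ZMod n), ∑ x : Equiv.Perm (ZMod n),
        if s = x⁻¹ * cyclicIncl n c * x then ZMod.stdAddChar c.toAdd else 0) *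
        ((Equiv.Perm.sign s : ℤ) : ℂ) := by
  have : Module.Finite ℂ (MonoidAlgebra ℂ (Equiv.Perm (ZMod n))) :=
    Module.Finite.of_basis (MonoidAlgebra.basis _ ℂ)
  rw [indChiSign, Representation.tprod_apply, LinearMap.trace_tensorProduct', signRep,
    trace_charRep, chiRep, trace_ind_charRep]
  simp only [Fintype.card_multiplicative, ZMod.card]
  rfl

/-- Each pair `(c, x)` contributes to exactly one `s`, a conjugate of `c`. Sign and cycle product
are class functions, so the sum over `x` gives a factor `n!` that cancels the normalization. -/
lemma frobChar_indChiSign :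
    frobChar (indChiSign n) = C ((n : ℂ)⁻¹) * ∑ c : Multiplicative (ZMod n),
      C (ZMod.stdAddChar c.toAdd * ((Equiv.Perm.sign (cyclicIncl n c) : ℤ) : ℂ)) *
        cyclePSum (cyclicIncl n c) := by
  have h1 : ∀ s : Equiv.Perm (ZMod n), C (LinearMap.trace ℂ _ (indChiSign n s)) * cyclePSum s =
      C ((n : ℂ)⁻¹) * ∑ c : Multiplicative (ZMod n), ∑ x : Equiv.Perm (ZMod n),
        if s = x⁻¹ * cyclicIncl n c * x then
          C (ZMod.stdAddChar c.toAdd * ((Equiv.Perm.sign (cyclicIncl n c) : ℤ) : ℂ)) *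
            cyclePSum (cyclicIncl n c) else 0 := by
    intro s
    rw [trace_indChiSign, mul_assoc, C_mul, mul_assoc, Finset.sum_mul, map_sum, Finset.sum_mul]
    congr 1
    refine Finset.sum_congr rfl fun c _ => ?_
    rw [Finset.sum_mul, map_sum, Finset.sum_mul]
    refine Finset.sum_congr rfl fun x _ => ?_
    split_ifs with h
    · rw [h, cyclePSum_conj, sign_conj]
    · simp
  have h2 : frobChar (indChiSign n) = C (1 / ((n.factorial : ℕ) : ℂ)) *
      ∑ s : Equiv.Perm (ZMod n), C (LinearMap.trace ℂ _ (indChiSign n s)) * cyclePSum s := by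
    refine congrArg₂ (· * ·) ?_ rfl
    rw [ZMod.card]
  rw [h2, Finset.sum_congr rfl fun s _ => h1 s, ← Finset.mul_sum, Finset.sum_comm, mul_left_comm]
  congr 1
  rw [Finset.mul_sum]
  refine Finset.sum_congr rfl fun c _ => ?_
  rw [Finset.sum_comm]
  simp only [Finset.sum_ite_eq', Finset.mem_univ, if_true, Finset.sum_const,
    Finset.card_univ, Fintype.card_perm, ZMod.card]
  rw [nsmul_eq_mul, ← mul_assoc, ← map_natCast (C : ℂ →+* MvPolynomial ℕ ℂ), ← C_mul,
    one_div_mul_cancel (Nat.cast_ne_zero.mpr n.factorial_ne_zero), C_1, one_mul]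

/-- Elements of `C_n` are grouped by their order `d`: each has sign `(-1)^(n + n/d)` and cycle
product `p_d^(n/d)`, and the values of `χ_n` sum to `μ(d)`. The sign splits as `(-1)^(n-1) (-1)^(n/d
- 1)`. -/
lemma map_logSym_eq_frobChar :
    MvPolynomial.map (Int.castRingHom ℂ) ((-1) ^ (n - 1) * logSym n) = frobChar (indChiSign n) := by
  have hn0 : n ≠ 0 := NeZero.ne n
  have hnc : (n : ℂ) ≠ 0 := Nat.cast_ne_zero.mpr hn0
  have h := congrArg (MvPolynomial.map (Int.castRingHom ℂ)) (nsmul_logSym n hn0)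
  rw [map_nsmul, nsmul_eq_mul, map_sum] at h
  refine mul_left_cancel₀ (a := (C (n : ℂ) : MvPolynomial ℕ ℂ)) (by simpa using hn0) ?_
  rw [frobChar_indChiSign, ← mul_assoc (C (n : ℂ)), ← C_mul, mul_inv_cancel₀ hnc, C_1, one_mul,
    map_mul, mul_left_comm, map_natCast, h,
    Nat.sum_divisorsAntidiagonal (fun i j => MvPolynomial.map (Int.castRingHom ℂ)
      (((ArithmeticFunction.moebius i : ℤ) * (-1) ^ (j - 1)) • pSym i ^ j)), Finset.mul_sum]
  have h1 : ∀ c : ZMod n, C (ZMod.stdAddChar c *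
      ((Equiv.Perm.sign (cyclicIncl n (Multiplicative.ofAdd c)) : ℤ) : ℂ)) *
      cyclePSum (cyclicIncl n (Multiplicative.ofAdd c)) =
      C (ZMod.stdAddChar c) * ((-1) ^ (n + n / addOrderOf c) *
        MvPolynomial.map (Int.castRingHom ℂ) (pSym (addOrderOf c)) ^ (n / addOrderOf c)) := by
    intro c
    have hp := parts_cyclicIncl n (Multiplicative.ofAdd c)
    rw [toAdd_ofAdd] at hp
    rw [cyclePSum, sign_eq_parts, sum_parts_partition, hp, Multiset.card_replicate,
      Multiset.map_replicate, Multiset.prod_replicate, C_mul, mul_assoc]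
    congr 2
    simp
  have h2 : ∑ c : Multiplicative (ZMod n),
      C (ZMod.stdAddChar c.toAdd * ((Equiv.Perm.sign (cyclicIncl n c) : ℤ) : ℂ)) *
        cyclePSum (cyclicIncl n c) = ∑ c : ZMod n, C (ZMod.stdAddChar c) *
        ((-1) ^ (n + n / addOrderOf c) *
        MvPolynomial.map (Int.castRingHom ℂ) (pSym (addOrderOf c)) ^ (n / addOrderOf c)) :=
    Fintype.sum_equiv Multiplicative.toAdd _ _ fun c => h1 c.toAdd
  rw [h2]
  refine Eq.trans ?_ (Finset.sum_fiberwise_of_maps_to (s := (Finset.univ : Finset (ZMod n)))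
    (t := n.divisors) (g := fun c : ZMod n => addOrderOf c) ?_ _)
  · refine Finset.sum_congr rfl fun d hd => ?_
    have hdn := Nat.dvd_of_mem_divisors hd
    have h3 : ∑ c : ZMod n with addOrderOf c = d, C (ZMod.stdAddChar c) *
        ((-1) ^ (n + n / addOrderOf c) *
        MvPolynomial.map (Int.castRingHom ℂ) (pSym (addOrderOf c)) ^ (n / addOrderOf c)) =
        C (∑ c : ZMod n with addOrderOf c = d, ZMod.stdAddChar c) * ((-1) ^ (n + n / d) *
          MvPolynomial.map (Int.castRingHom ℂ) (pSym d) ^ (n / d)) := by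
      rw [map_sum, Finset.sum_mul]
      refine Finset.sum_congr rfl fun c hc => ?_
      rw [(Finset.mem_filter.mp hc).2]
    rw [h3, sum_stdAddChar_addOrderOf n d hdn, zsmul_eq_mul, map_mul, map_pow, map_pow]
    have hm : 1 ≤ n / d := Nat.div_pos (Nat.le_of_dvd (NeZero.pos n) hdn)
      (Nat.pos_of_dvd_of_pos hdn (NeZero.pos n))
    have hs : ((-1) ^ (n + n / d) : MvPolynomial ℕ ℂ) = (-1) ^ (n - 1) * (-1) ^ (n / d - 1) := by
      rw [← pow_add]
      have : n + n / d = n - 1 + (n / d - 1) + 2 := by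
        have := NeZero.pos n
        omega
      rw [this, pow_add _ _ 2, neg_one_sq, mul_one]
    rw [hs]
    simp only [map_mul, map_pow, map_neg, map_one, map_intCast, Int.cast_mul, Int.cast_pow, Int.cast_neg,
      Int.cast_one]
    ring
  · intro c _
    rw [Nat.mem_divisors]
    refine ⟨?_, hn0⟩
    have := addOrderOf_dvd_natCard c
    rwa [Nat.card_eq_fintype_card, ZMod.card] at this

end Characteristic

section Act

variable {R : Type*} [CommRing R] (S : PreLambdaRing R)

lemma PreLambdaRing.act_sum {α : Type*} (s : Finset α) (f : α → SymFun) (a : R) :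
    S.act (∑ i ∈ s, f i) a = ∑ i ∈ s, S.act (f i) a :=
  map_sum (aeval (R := ℤ) fun n => S.σ (n + 1) a) _ _

lemma PreLambdaRing.act_sub (f g : SymFun) (a : R) : S.act (f - g) a = S.act f a - S.act g a :=
  map_sub (aeval (R := ℤ) fun n => S.σ (n + 1) a) _ _

lemma PreLambdaRing.act_one_add_X_zero (a : R) : S.act (1 + X 0) a = 1 + a := by
  rw [PreLambdaRing.act, map_add, map_one, aeval_X, zero_add, S.σ_one]

lemma nsmul_act_logSym (n : ℕ) (hn : n ≠ 0) (a : R) :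
    n • S.act (logSym n) a = ∑ d ∈ n.divisorsAntidiagonal,
      ((ArithmeticFunction.moebius d.1 : ℤ) * (-1) ^ (d.2 - 1)) • S.ψ d.1 a ^ d.2 := by
  have h := congrArg (aeval (R := ℤ) fun n => S.σ (n + 1) a) (nsmul_logSym n hn)
  simp only [map_nsmul, map_sum, map_zsmul, map_pow] at h
  exact h

end Act

/-! ### Exponential and logarithm in a complete filtered `λ`-ring -/

section Complete

variable {R : Type*} [CommRing R] {S : FilteredLambdaRing R}

lemma FilteredLambdaRing.eq_zero_of_forall_mem {x : R} (hx : ∀ k, x ∈ S.F k) : x = 0 := by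
  have : x ∈ ⨅ k, S.F k := AddSubgroup.mem_iInf.mpr hx
  rwa [S.F_iInf, AddSubgroup.mem_bot] at this

lemma FilteredLambdaRing.eq_of_forall_sub_mem {x y : R} (h : ∀ k, x - y ∈ S.F k) : x = y :=
  sub_eq_zero.mp (FilteredLambdaRing.eq_zero_of_forall_mem h)

/-- All limits below are kept in this stronger form, with the explicit rate that the first `k` terms
determine the sum modulo `F k`. -/
lemma hasSeriesSum_of_forall_sub_mem {u : ℕ → R} {s : R}
    (h : ∀ k, s - ∑ i ∈ Finset.range k, u i ∈ S.F k) : S.HasSeriesSum u s := fun k =>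
  ⟨k, fun n hn => by
    rw [← neg_sub]
    exact neg_mem (S.F_antitone hn (h n))⟩

lemma FilteredLambdaRing.IsComplete.exists_sum (hS : S.IsComplete) {u : ℕ → R}
    (hu : ∀ n, u n ∈ S.F n) : ∃ s, ∀ k, s - ∑ i ∈ Finset.range k, u i ∈ S.F k :=
  hS (fun k => ∑ i ∈ Finset.range k, u i) fun k => by
    rw [Finset.sum_range_succ, add_sub_cancel_left]
    exact hu k

lemma sigma_mem_F {a : R} (ha : a ∈ S.F 1) (n : ℕ) : S.σ n a ∈ S.F n :=
  S.isFiltration.sigma_mem ha (mul_one n).ge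

lemma act_logSym_mem {a : R} (ha : a ∈ S.F 1) (n : ℕ) : S.act (logSym n) a ∈ S.F n :=
  S.isFiltration.act_mem (logSym_mem_lowFilt n) ha

lemma sub_expSum_mem {a e : R} (he : ∀ k, e - ∑ i ∈ Finset.range k, S.σ i a ∈ S.F k) (M : ℕ) :
    e - S.expSum M a ∈ S.F (M + 1) := he (M + 1)

/-- `Exp` takes the logarithm series of `1 + a` to `1 + a`. -/
lemma exp_log {a l e : R} (ha : a ∈ S.F 1)
    (hl : ∀ k, l - ∑ i ∈ Finset.range k, S.act (logSym (i + 1)) a ∈ S.F k)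
    (he : ∀ k, e - ∑ i ∈ Finset.range k, S.σ i l ∈ S.F k) : e = 1 + a := by
  have key : ∀ M, e - (1 + a) ∈ S.F (M + 1) := by
    intro M
    -- The hypothesis sums `logSym` up to index `M + 1`, while `logApprox M` stops at `M`; the extra
    -- term already lies in `F (M + 1)`.
    have h1 : l - S.act (logApprox M) a ∈ S.F (M + 1) := by
      have h := add_mem (hl (M + 1)) (act_logSym_mem ha (M + 1))
      rw [Finset.sum_range_succ] at h
      rw [logApprox_eq_sum, PreLambdaRing.act_sum, Finset.sum_range_succ']
      have h0 : S.act (logSym 0) a = 0 := map_zero (aeval (R := ℤ) fun n => S.σ (n + 1) a)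
      rw [h0]
      convert h using 1
      ring
    have h2 := S.isFiltration.expSum_congr h1 M
    have h3 := S.isFiltration.act_mem (expSum_logApprox M) ha
    rw [PreLambdaRing.act_sub, PreLambdaRing.act_one_add_X_zero, ← LambdaRing.expSum_act] at h3
    have := add_mem (add_mem (sub_expSum_mem he M) h2) h3
    convert this using 1
    ring
  exact FilteredLambdaRing.eq_of_forall_sub_mem fun k => S.F_antitone (Nat.le_succ k) (key k)

/-- If `a - b ∈ F (M + 1)`, then `expSum_add` with `y = b` and `L = a - b` shows that the two
exponentials differ by `a - b` modulo `F (M + 2)`. As they are equal, `a - b` moves one step deeper,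
and the filtration is separated. -/
lemma exp_injective {a b e : R} (ha : a ∈ S.F 1) (hb : b ∈ S.F 1)
    (hea : ∀ k, e - ∑ i ∈ Finset.range k, S.σ i a ∈ S.F k)
    (heb : ∀ k, e - ∑ i ∈ Finset.range k, S.σ i b ∈ S.F k) : a = b := by
  have key : ∀ M, a - b ∈ S.F (M + 1) := by
    intro M
    induction M with
    | zero => exact sub_mem ha hb
    | succ M ih =>
      have h := S.isFiltration.expSum_add hb ih M
      rw [add_sub_cancel] at h
      have := sub_mem (sub_mem (sub_expSum_mem heb (M + 1)) (sub_expSum_mem hea (M + 1))) h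
      convert this using 1
      ring
  exact FilteredLambdaRing.eq_of_forall_sub_mem fun k => S.F_antitone (Nat.le_succ k) (key k)

lemma exp_sub_one_mem {a e : R} (he : ∀ k, e - ∑ i ∈ Finset.range k, S.σ i a ∈ S.F k) :
    e - 1 ∈ S.F 1 := by
  simpa [S.σ_zero] using he 1

lemma log_mem {a l : R} (ha : a ∈ S.F 1)
    (hl : ∀ k, l - ∑ i ∈ Finset.range k, S.act (logSym (i + 1)) a ∈ S.F k) : l ∈ S.F 1 := by
  have := add_mem (hl 1) (act_logSym_mem ha 1)
  rw [Finset.sum_range_one] at this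
  convert this using 1
  ring

/-- The exponential bijection of a complete filtered `λ`-ring, with the logarithm series as its
inverse. -/
lemma exists_expEquiv (hS : S.IsComplete) :
    ∃ Exp : {a : R // a ∈ S.F 1} ≃ {b : R // b - 1 ∈ S.F 1},
      (∀ (a : {a : R // a ∈ S.F 1}) k,
        (Exp a : R) - ∑ i ∈ Finset.range k, S.σ i a ∈ S.F k) ∧
      (∀ (b : {b : R // b - 1 ∈ S.F 1}) k,
        (Exp.symm b : R) - ∑ i ∈ Finset.range k, S.act (logSym (i + 1)) (b - 1) ∈ S.F k) := by
  have h1 : ∀ a : {a : R // a ∈ S.F 1},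
      ∃ e : R, ∀ k, e - ∑ i ∈ Finset.range k, S.σ i a ∈ S.F k :=
    fun a => hS.exists_sum fun n => sigma_mem_F a.2 n
  have h2 : ∀ b : {b : R // b - 1 ∈ S.F 1},
      ∃ l : R, ∀ k, l - ∑ i ∈ Finset.range k, S.act (logSym (i + 1)) (b - 1) ∈ S.F k :=
    fun b => hS.exists_sum fun n => S.F_antitone (Nat.le_succ n) (act_logSym_mem b.2 (n + 1))
  choose exp hexp using h1
  choose log hlog using h2
  have hel : ∀ b (hb : log b ∈ S.F 1), exp ⟨log b, hb⟩ = b := fun b hb =>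
    (exp_log b.2 (hlog b) (hexp ⟨log b, hb⟩)).trans (add_sub_cancel _ _)
  refine ⟨⟨fun a => ⟨exp a, exp_sub_one_mem (hexp a)⟩, fun b => ⟨log b, log_mem b.2 (hlog b)⟩,
    fun a => ?_, fun b => ?_⟩, hexp, hlog⟩
  -- The left inverse comes from injectivity: `exp (log (exp a)) = exp a` by the right inverse.
  · refine Subtype.ext (exp_injective (log_mem ?_ (hlog _)) a.2 (hexp ⟨log _, ?_⟩) ?_)
    · exact exp_sub_one_mem (hexp a)
    · exact log_mem (exp_sub_one_mem (hexp a)) (hlog _)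
    · rw [hel]
      exact hexp a
  · exact Subtype.ext (hel b _)

/-! ### The logarithm formula over `ℚ` -/

section Rational

lemma isWeightedHomogeneous_pSym (n : ℕ) : IsWeightedHomogeneous wt (pSym n) n := by
  cases n with
  | zero => rw [pSym]; exact isWeightedHomogeneous_zero _ _ _
  | succ n =>
    have : weightedHomogeneousComponent wt (n + 1) (pSym (n + 1)) = pSym (n + 1) := by
      refine toVars_ext fun N => ?_
      rw [toVars_weightedHomogeneousComponent, toVars_pSym]
      refine weightedHomogeneousComponent_eq_self ?_
      refine IsWeightedHomogeneous.sum _ _ _ fun i _ => ?_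
      simpa using (isWeightedHomogeneous_X ℤ (1 : Fin N → ℕ) i).pow (n + 1)
    rw [← this]
    exact weightedHomogeneousComponent_isWeightedHomogeneous _ _

lemma psi_pow_mem {a : R} (ha : a ∈ S.F 1) (n m : ℕ) : S.ψ n a ^ m ∈ S.F (n * m) :=
  S.isFiltration.pow_mem (S.isFiltration.act_mem
    (mem_lowFilt_of_isWeightedHomogeneous (isWeightedHomogeneous_pSym n)) ha) m

variable [Algebra ℚ R]

lemma qsmul_mem {k : ℕ} {x : R} (q : ℚ) (hx : x ∈ S.F k) : q • x ∈ S.F k := by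
  rw [Algebra.smul_def]
  exact S.isFiltration.mul_mem_left _ hx

/-- The terms of the double series of the plethystic logarithm. -/
def logTerm (S : FilteredLambdaRing R) (a : R) (d m : ℕ) : R :=
  ((ArithmeticFunction.moebius d : ℚ) / (d : ℚ) * ((-1) ^ (m - 1) / (m : ℚ))) • S.ψ d a ^ m

lemma act_logSym_eq (a : R) (n : ℕ) :
    S.act (logSym n) a = ∑ d ∈ n.divisorsAntidiagonal, logTerm S a d.1 d.2 := by
  rcases eq_or_ne n 0 with rfl | hn
  · exact map_zero (aeval (R := ℤ) fun n => S.σ (n + 1) a)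
  have hnq : (n : ℚ) ≠ 0 := Nat.cast_ne_zero.mpr hn
  have h := nsmul_act_logSym S.toPreLambdaRing n hn a
  rw [← Nat.cast_smul_eq_nsmul ℚ] at h
  have h2 := congrArg (fun x => (n : ℚ)⁻¹ • x) h
  simp only [smul_smul, inv_mul_cancel₀ hnq, one_smul, Finset.smul_sum] at h2
  rw [h2]
  refine Finset.sum_congr rfl fun d hd => ?_
  obtain ⟨hd1, -⟩ := Nat.mem_divisorsAntidiagonal.mp hd
  have h1 : (d.1 : ℚ) ≠ 0 := Nat.cast_ne_zero.mpr (left_ne_zero_of_mul (hd1.trans_ne hn))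
  have h2 : (d.2 : ℚ) ≠ 0 := Nat.cast_ne_zero.mpr (right_ne_zero_of_mul (hd1.trans_ne hn))
  rw [logTerm, ← Int.cast_smul_eq_zsmul ℚ, smul_smul]
  congr 1
  rw [← hd1]
  push_cast
  field_simp

/-- The first sum runs over the square `d, m ≤ n`, the second over the region `d m ≤ n` inside it.
In the difference `d m > n`, so each term lies in `F n`. -/
lemma sum_logTerm_sub_mem {a : R} (ha : a ∈ S.F 1) (n : ℕ) :
    ∑ d ∈ Finset.range n, ∑ m ∈ Finset.range n, logTerm S a (d + 1) (m + 1) -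
      ∑ j ∈ Finset.range n, S.act (logSym (j + 1)) a ∈ S.F n := by
  -- As division by zero gives zero, terms with `d = 0` or `m = 0` vanish and may be added to make
  -- both index ranges start at `0`.
  have hd0 : ∀ m, logTerm S a 0 m = 0 := fun m => by simp [logTerm]
  have hm0 : ∀ d, logTerm S a d 0 = 0 := fun d => by simp [logTerm]
  have h0 : S.act (logSym 0) a = 0 := map_zero (aeval (R := ℤ) fun n => S.σ (n + 1) a)
  set s := Finset.range (n + 1) ×ˢ Finset.range (n + 1) with hs
  have h1 : ∑ d ∈ Finset.range n, ∑ m ∈ Finset.range n, logTerm S a (d + 1) (m + 1) =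
      ∑ p ∈ s, logTerm S a p.1 p.2 := by
    simp only [hs, Finset.sum_product, Finset.sum_range_succ' _ n, hd0, hm0,
      Finset.sum_const_zero, add_zero]
  have h2 : ∑ j ∈ Finset.range n, S.act (logSym (j + 1)) a =
      ∑ p ∈ s with p.1 * p.2 ≤ n, logTerm S a p.1 p.2 := by
    have e : ∑ j ∈ Finset.range n, S.act (logSym (j + 1)) a =
        ∑ j ∈ Finset.range (n + 1), S.act (logSym j) a := by
      rw [Finset.sum_range_succ' _ n, h0, add_zero]
    rw [e, ← Finset.sum_fiberwise_of_maps_to (t := Finset.range (n + 1))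
      (g := fun p : ℕ × ℕ => p.1 * p.2)]
    · refine Finset.sum_congr rfl fun j hj => ?_
      rcases eq_or_ne j 0 with rfl | hj0
      · rw [h0, Finset.sum_eq_zero]
        intro p hp
        rcases mul_eq_zero.mp (Finset.mem_filter.mp hp).2 with h | h
        · rw [h, hd0]
        · rw [h, hm0]
      · rw [act_logSym_eq]
        refine Finset.sum_congr ?_ fun _ _ => rfl
        have hjn := Nat.lt_succ_iff.mp (Finset.mem_range.mp hj)
        ext p
        simp only [hs, Nat.mem_divisorsAntidiagonal, Finset.mem_filter, Finset.mem_product,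
          Finset.mem_range, Nat.lt_succ_iff]
        refine ⟨fun h => ⟨⟨⟨?_, ?_⟩, ?_⟩, h.1⟩, fun h => ⟨h.2, hj0⟩⟩
        · exact (Nat.le_of_dvd (Nat.pos_of_ne_zero hj0) ⟨_, h.1.symm⟩).trans hjn
        · exact (Nat.le_of_dvd (Nat.pos_of_ne_zero hj0) ⟨_, ((mul_comm _ _).trans h.1).symm⟩).trans
            hjn
        · rw [h.1]
          exact hjn
    · intro p hp
      exact Finset.mem_range.mpr (Nat.lt_succ_of_le (Finset.mem_filter.mp hp).2)
  rw [h1, h2, ← Finset.sum_filter_add_sum_filter_not s (fun p => p.1 * p.2 ≤ n),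
    add_sub_cancel_left]
  refine sum_mem fun p hp => qsmul_mem _ ?_
  have := (Finset.mem_filter.mp hp).2
  exact S.F_antitone (by omega) (psi_pow_mem ha p.1 p.2)

/-- Over `ℚ` the logarithm is the series of the series `(μ(n) / n) log(1 + ψ_n(a))`. -/
lemma exists_log_series (hS : S.IsComplete) {a l : R} (ha : a ∈ S.F 1)
    (hl : ∀ k, l - ∑ i ∈ Finset.range k, S.act (logSym (i + 1)) a ∈ S.F k) :
    ∃ L : ℕ → R,
      (∀ n : ℕ, 1 ≤ n → S.HasSeriesSum
        (fun m => ((-1 : ℚ) ^ m / ((m + 1 : ℕ) : ℚ)) • S.ψ n a ^ (m + 1)) (L n)) ∧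
      S.HasSeriesSum
        (fun n => ((ArithmeticFunction.moebius (n + 1) : ℚ) / ((n + 1 : ℕ) : ℚ)) • L (n + 1)) l := by
  -- For `n = 0` the value is a dummy. For `n ≥ 1` the terms tend to zero because `n (m + 1) ≥ m`.
  have h1 : ∀ n : ℕ, ∃ s : R, 1 ≤ n → ∀ k, s - ∑ m ∈ Finset.range k,
      ((-1 : ℚ) ^ m / ((m + 1 : ℕ) : ℚ)) • S.ψ n a ^ (m + 1) ∈ S.F k := by
    intro n
    by_cases hn : 1 ≤ n
    · obtain ⟨s, hs⟩ := hS.exists_sum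
        (u := fun m => ((-1 : ℚ) ^ m / ((m + 1 : ℕ) : ℚ)) • S.ψ n a ^ (m + 1)) fun m =>
          qsmul_mem _ (S.F_antitone (by nlinarith) (psi_pow_mem ha n (m + 1)))
      exact ⟨s, fun _ => hs⟩
    · exact ⟨0, fun h => absurd h hn⟩
  choose L hL using h1
  refine ⟨L, fun n hn => hasSeriesSum_of_forall_sub_mem (hL n hn),
    hasSeriesSum_of_forall_sub_mem fun k => ?_⟩
  -- Each inner logarithm may be cut after `k` terms modulo `F k`, which leaves the square partial
  -- sum of the double series.
  have h2 : ∑ n ∈ Finset.range k, ((ArithmeticFunction.moebius (n + 1) : ℚ) /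
      ((n + 1 : ℕ) : ℚ)) • L (n + 1) -
      ∑ d ∈ Finset.range k, ∑ m ∈ Finset.range k, logTerm S a (d + 1) (m + 1) ∈ S.F k := by
    rw [← Finset.sum_sub_distrib]
    refine sum_mem fun d _ => ?_
    have := qsmul_mem ((ArithmeticFunction.moebius (d + 1) : ℚ) / ((d + 1 : ℕ) : ℚ))
      (hL (d + 1) (Nat.le_add_left 1 d) k)
    rw [smul_sub, Finset.smul_sum] at this
    simpa only [smul_smul, logTerm, Nat.add_sub_cancel] using this
  have := sub_mem (hl k) (add_mem h2 (sum_logTerm_sub_mem ha k))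
  convert this using 1
  ring

end Rational

end Complete

end CompleteLambda

end

theorem mainTheorem5 :
    ∃ L : ℕ → CompleteLambda.SymFun,
      (∀ n : ℕ, 1 ≤ n →
        MvPolynomial.map (Int.castRingHom ℚ) (L n) = CompleteLambda.logPart n) ∧
      (∀ (n : ℕ) [NeZero n],
        MvPolynomial.map (Int.castRingHom ℂ) ((-1) ^ (n - 1) * L n) =
          CompleteLambda.frobChar (CompleteLambda.indChiSign n)) ∧
      ∀ (R : Type*) [CommRing R] (S : CompleteLambda.FilteredLambdaRing R), S.IsComplete →
        (∀ n : ℕ, 1 ≤ n → ∀ a ∈ S.F 1, S.act (L n) a ∈ S.F n) ∧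
        ∃ Exp : {a : R // a ∈ S.F 1} ≃ {b : R // b - 1 ∈ S.F 1},
          (∀ a : {a : R // a ∈ S.F 1}, S.HasSeriesSum (fun n => S.σ n a) (Exp a)) ∧
          (∀ b : {b : R // b - 1 ∈ S.F 1},
            S.HasSeriesSum (fun n => S.act (L (n + 1)) (b - 1)) (Exp.symm b)) ∧
          (∀ [Algebra ℚ R] (b : {b : R // b - 1 ∈ S.F 1}),
            ∃ l : ℕ → R,
              (∀ n : ℕ, 1 ≤ n → S.HasSeriesSum
                (fun m => ((-1 : ℚ) ^ m / ((m + 1 : ℕ) : ℚ)) • S.ψ n ((b : R) - 1) ^ (m + 1))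
                (l n)) ∧
              S.HasSeriesSum
                (fun n => ((ArithmeticFunction.moebius (n + 1) : ℚ) / ((n + 1 : ℕ) : ℚ)) •
                  l (n + 1))
                (Exp.symm b)) := by
  refine ⟨CompleteLambda.logSym, CompleteLambda.map_logSym,
    fun n _ => CompleteLambda.map_logSym_eq_frobChar n, fun R _ S hS =>
    ⟨fun n _ a ha => CompleteLambda.act_logSym_mem ha n, ?_⟩⟩
  obtain ⟨Exp, h1, h2⟩ := CompleteLambda.exists_expEquiv hS
  exact ⟨Exp, fun a => CompleteLambda.hasSeriesSum_of_forall_sub_mem (h1 a),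
    fun b => CompleteLambda.hasSeriesSum_of_forall_sub_mem (h2 b),
    fun b => CompleteLambda.exists_log_series hS b.2 (h2 b)⟩
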